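/- Let $M$ be a smooth manifold of dimension $d$ (in particular the 4-dimensional space-time). All coordinate systems are local smooth coordinate systems on open subsets of $M$. **(1)** Let $g$ be a smooth metric on $M$ of fixed signature $\varepsilon=(\varepsilon_1,\dots,\varepsilon_d)$, $\varepsilon_i=\pm1$: a smooth symmetric covariant 2-tensor which at every point equals $\eta=\mathrm{diag}(\varepsilon_1,\dots,\varepsilon_d)$ in a suitable basis of the tangent space. (Riemannian metrics are the case $\varepsilon_i=1$ for all $i$, $\eta_{ij}=\delta_{ij}$; in the Minkowski-type case $\eta$ is the Minkowski matrix.) In coordinates let $\Gamma^k_{ij}=\frac12 g^{kl}(\partial_i g_{jl}+\partial_j g_{il}-\partial_l g_{ij})$ and $R^l{}_{kij}=\partial_i\Gamma^l_{jk}-\partial_j\Gamma^l_{ik}+\Gamma^l_{im}\Gamma^m_{jk}-\Gamma^l_{jm}\Gamma^m_{ik}$. Call $M$ *curved* if the curvature tensor $R$ does not vanish identically on $M$. Then the following are equivalent: * $M$ is curved; * $\Gamma\neq0$ in all coordinates, i.e. there is a point $p\in M$ such that in every coordinate system around $p$ the symbols $\Gamma^k_{ij}$ do not all vanish identically (equivalently,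 $M$ cannot be covered by coordinate systems in which $\Gamma\equiv0$); * $g_{ij}\neq\eta_{ij}$ in all coordinates, i.e. there is a point $p\in M$ such that in no coordinate system around $p$ does $g_{ij}=\eta_{ij}$ hold throughout. Moreover, for each individual point $p$, the condition on $p$ in the second item is equivalent to the condition on $p$ in the third. **(2)** Let $G$ be $U(n)$ or $SU(n)$, let $c\in\mathbb R\setminus\{0\}$ be a coupling constant, and let $A$ be a smooth gauge field, that is, a smooth one-form on $M$ with values in the Hermitian $n\times n$ matrices (trace-free if $G=SU(n)$). Let $M\otimes_p\mathbb C^n=M\times\mathbb C^n$ be the product bundle, $\nabla$ its product connection, and $D=\nabla+icA$. Call the bundle with the connection $D$ *twisted* if its curvature $F_{ij}=\partial_iA_j-\partial_jA_i+ic[A_i,A_j]$ does not vanish identically, and *geometrically nontrivial* if some point of $M$ has no neighbourhood on which there is a smooth frame $s_1,\dots,s_n$ of the bundle with $Ds_a=0$ for all $a$. A gauge transformation on an open set $U$ is a smooth map $\Omega:U\to G$; it changes $A$ into $\Omega A\Omega^{-1}+\frac ic(d\Omega)\Omega^{-1}$. Then the following are equivalent: * $M\otimes_p\mathbb C^n$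 is twisted; * $M\otimes_p\mathbb C^n$ is geometrically nontrivial; * $A\neq0$ in all gauges, i.e. there is a point $p\in M$ such that no gauge transformation on any open neighbourhood of $p$ transforms $A$ into a field vanishing identically there. Moreover, in the given gauge, $A\neq0$ (that is, $A$ does not vanish identically) if and only if $D$ differs from the product connection, i.e. $Ds\neq\nabla s$ for some smooth section $s$. -/

import Mathlib

open Set
open scoped Manifold ContDiff Topology

noncomputable section

namespace GeomInteraction

/-- The coordinate space `ℝ^d`. -/
abbrev Coord (d : ℕ) : Type := EuclideanSpace ℝ (Fin d)

/-- The partial derivative `∂f/∂x^i` of a function of the coordinates. -/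
def pd {d : ℕ} {F : Type*} [NormedAddCommGroup F] [NormedSpace ℝ F]
    (i : Fin d) (f : Coord d → F) (x : Coord d) : F :=
  fderiv ℝ f x (EuclideanSpace.single i 1)

section Manifolds

variable {d : ℕ} {M : Type*} [TopologicalSpace M] [ChartedSpace (Coord d) M]

/-- `IsCoord e`: `e` is a (smooth) coordinate system on the open set `e.source` of `M`, with
coordinate domain `e.target ⊆ ℝ^d`. -/
def IsCoord (e : OpenPartialHomeomorph M (Coord d)) : Prop :=
  e ∈ IsManifold.maximalAtlas (𝓡 d) ∞ M

/-- The coordinate vector field `∂/∂x^i` of the coordinate system `e`, at the point of `M` with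
coordinates `x ∈ e.target`. -/
def coordVec (e : OpenPartialHomeomorph M (Coord d)) (i : Fin d) (x : Coord d) :
    TangentSpace (𝓡 d) (e.symm x) :=
  mfderiv (𝓡 d) (𝓡 d) e.symm x (EuclideanSpace.single i (1 : ℝ) : Coord d)

variable (d M) in
/-- A smooth metric on `M` which at every point takes the form `diag(ε_1, …, ε_d)` (each
`ε_i = ± 1`) in some basis of the tangent space.  Riemannian metrics are the case `ε = 1`, metrics
of Minkowski type the case where exactly one sign differs from the others.  Smoothness is
smoothness of the components in all coordinate systems. -/
structure Metric (ε : Fin d → ℤˣ) where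
  val : ∀ p : M, TangentSpace (𝓡 d) p →ₗ[ℝ] TangentSpace (𝓡 d) p →ₗ[ℝ] ℝ
  symm : ∀ p v w, val p v w = val p w v
  signature : ∀ p : M, ∃ b : Module.Basis (Fin d) ℝ (TangentSpace (𝓡 d) p),
    ∀ i j, val p (b i) (b j) = if i = j then ((ε i : ℤ) : ℝ) else 0
  smooth : ∀ e : OpenPartialHomeomorph M (Coord d), IsCoord e → ∀ i j,
    ContDiffOn ℝ ∞ (fun x => val (e.symm x) (coordVec e i x) (coordVec e j x)) e.target

/-- The diagonal matrix `diag(ε_1, …, ε_d)`; this is `δ_ij` in the Riemannian case `ε = 1`. -/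
def eta {d : ℕ} (ε : Fin d → ℤˣ) : Matrix (Fin d) (Fin d) ℝ :=
  Matrix.diagonal fun i => ((ε i : ℤ) : ℝ)

namespace Metric

variable {ε : Fin d → ℤˣ} (g : Metric d M ε) (e : OpenPartialHomeomorph M (Coord d))

/-- The matrix `(g_ij)` of components of the metric in the coordinate system `e`. -/
def comp (x : Coord d) : Matrix (Fin d) (Fin d) ℝ :=
  Matrix.of fun i j => g.val (e.symm x) (coordVec e i x) (coordVec e j x)

/-- The Christoffel symbol
`Γ^k_ij = (1/2) g^{kl} (∂_i g_jl + ∂_j g_il - ∂_l g_ij)` in the coordinate system `e`. -/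
def christoffel (k i j : Fin d) (x : Coord d) : ℝ :=
  (1 / 2) * ∑ l, (g.comp e x)⁻¹ k l *
    (pd i (fun y => g.comp e y j l) x + pd j (fun y => g.comp e y i l) x
      - pd l (fun y => g.comp e y i j) x)

/-- The component `R^l_kij = ∂_i Γ^l_jk - ∂_j Γ^l_ik + Γ^l_im Γ^m_jk - Γ^l_jm Γ^m_ik` of the
Riemann curvature tensor in the coordinate system `e`. -/
def riemann (l k i j : Fin d) (x : Coord d) : ℝ :=
  pd i (g.christoffel e l j k) x - pd j (g.christoffel e l i k) x
    + ∑ m, (g.christoffel e l i m x * g.christoffel e m j k x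
      - g.christoffel e l j m x * g.christoffel e m i k x)

/-- `M` is curved: its Riemann curvature tensor does not vanish identically. -/
def IsCurved : Prop :=
  ∃ e : OpenPartialHomeomorph M (Coord d), IsCoord e ∧
    ∃ x ∈ e.target, ∃ l k i j, g.riemann e l k i j x ≠ 0

/-- `Γ ≠ 0` in all coordinate systems around `p`: in none of them do the Christoffel symbols
vanish identically. -/
def ChristoffelNeZero (p : M) : Prop :=
  ∀ e : OpenPartialHomeomorph M (Coord d), IsCoord e → p ∈ e.source →
    ∃ x ∈ e.target, ∃ k i j, g.christoffel e k i j x ≠ 0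

/-- `(g_ij) ≠ diag(ε_1, …, ε_d)` in all coordinate systems around `p`: in none of them does the
identity `(g_ij) = diag(ε_1, …, ε_d)` hold throughout. -/
def CompNeEta (p : M) : Prop :=
  ∀ e : OpenPartialHomeomorph M (Coord d), IsCoord e → p ∈ e.source →
    ∃ x ∈ e.target, g.comp e x ≠ eta ε

end Metric

/-- The two families of gauge groups, `U(n)` and `SU(n)`. -/
inductive GaugeGroup
  | U
  | SU

/-- The group `U(n)` or `SU(n)`. -/
def GaugeGroup.group (K : GaugeGroup) (n : ℕ) : Set (Matrix (Fin n) (Fin n) ℂ) :=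
  match K with
  | .U => {X | X ∈ Matrix.unitaryGroup (Fin n) ℂ}
  | .SU => {X | X ∈ Matrix.specialUnitaryGroup (Fin n) ℂ}

/-- The real span of the Hermitian generators `τ` of the group, `e^{iθτ}` being its elements:
Hermitian matrices for `U(n)`, trace-free Hermitian matrices for `SU(n)`. -/
def GaugeGroup.generators (K : GaugeGroup) (n : ℕ) : Set (Matrix (Fin n) (Fin n) ℂ) :=
  match K with
  | .U => {X | X.IsHermitian}
  | .SU => {X | X.IsHermitian ∧ X.trace = 0}

variable (d M) in
/-- A smooth gauge field `A = A^a_μ τ_a dx^μ` on `M`: a one-form with values in the span of the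
generators. -/
structure GaugeField (K : GaugeGroup) (n : ℕ) where
  val : ∀ p : M, TangentSpace (𝓡 d) p →ₗ[ℝ] Matrix (Fin n) (Fin n) ℂ
  mem : ∀ p v, val p v ∈ K.generators n
  smooth : ∀ e : OpenPartialHomeomorph M (Coord d), IsCoord e → ∀ i a b,
    ContDiffOn ℝ ∞ (fun x => val (e.symm x) (coordVec e i x) a b) e.target

namespace GaugeField

variable {K : GaugeGroup} {n : ℕ} (A : GaugeField d M K n) (c : ℝ)

/-- The component matrix `A_i` in the coordinate system `e`. -/
def comp (e : OpenPartialHomeomorph M (Coord d)) (i : Fin d) (x : Coord d) :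
    Matrix (Fin n) (Fin n) ℂ :=
  A.val (e.symm x) (coordVec e i x)

/-- The component `F_ij = ∂_i A_j - ∂_j A_i + i c [A_i, A_j]`, in the coordinate system `e`, of the
curvature of the connection `D = ∇ + i c A` (so that `[D_i, D_j] = i c F_ij`). -/
def curvature (e : OpenPartialHomeomorph M (Coord d)) (i j : Fin d) (x : Coord d) :
    Matrix (Fin n) (Fin n) ℂ :=
  Matrix.of (fun a b => pd i (fun y => A.comp e j y a b) x - pd j (fun y => A.comp e i y a b) x)
    + (Complex.I * (c : ℂ)) • (A.comp e i x * A.comp e j x - A.comp e j x * A.comp e i x)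

/-- The bundle `M ⊗_p ℂ^n` with the connection `D = ∇ + i c A` is twisted: its curvature does not
vanish identically. -/
def IsTwisted : Prop :=
  ∃ e : OpenPartialHomeomorph M (Coord d), IsCoord e ∧
    ∃ x ∈ e.target, ∃ i j, A.curvature c e i j x ≠ 0

/-- The derivative `∇_v s` of a section `s` of the product bundle `M ⊗_p ℂ^n` with respect to the
product connection. -/
def flatDeriv (s : M → Fin n → ℂ) (p : M) (v : TangentSpace (𝓡 d) p) : Fin n → ℂ :=
  mfderiv (𝓡 d) 𝓘(ℝ, Fin n → ℂ) s p v

/-- The covariant derivative `D_v s = ∇_v s + i c A(v) s`. -/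
def covDeriv (s : M → Fin n → ℂ) (p : M) (v : TangentSpace (𝓡 d) p) : Fin n → ℂ :=
  flatDeriv s p v + (Complex.I * (c : ℂ)) • (A.val p v).mulVec (s p)

/-- Around `p` the bundle `M ⊗_p ℂ^n` with its connection `D` is isomorphic to a product bundle
with the product connection: there is a smooth frame `s_1, …, s_n` with `D s_a = 0`. -/
def HasParallelFrameNear (p : M) : Prop :=
  ∃ U : Set M, IsOpen U ∧ p ∈ U ∧ ∃ s : Fin n → M → Fin n → ℂ,
    (∀ a, ContMDiffOn (𝓡 d) 𝓘(ℝ, Fin n → ℂ) ∞ (s a) U) ∧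
    (∀ q ∈ U, LinearIndependent ℂ fun a => s a q) ∧
    ∀ q ∈ U, ∀ a v, A.covDeriv c (s a) q v = 0

/-- The bundle `M ⊗_p ℂ^n` with its connection `D` is geometrically nontrivial: it is not locally
isomorphic to a product bundle with the product connection. -/
def IsGeometricallyNontrivial : Prop :=
  ∃ p : M, ¬ A.HasParallelFrameNear c p

/-- The gauge field `Ω A Ω⁻¹ + (i / c) (dΩ) Ω⁻¹` obtained from `A` by the gauge transformation
`s ↦ Ω s`. -/
def transform (Ω : M → Matrix (Fin n) (Fin n) ℂ) (p : M) (v : TangentSpace (𝓡 d) p) :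
    Matrix (Fin n) (Fin n) ℂ :=
  Ω p * A.val p v * (Ω p)⁻¹
    + (Complex.I / (c : ℂ)) •
      (Matrix.of (fun a b => (mfderiv (𝓡 d) 𝓘(ℝ, ℂ) (fun q => Ω q a b) p v : ℂ)) * (Ω p)⁻¹)

/-- `A ≠ 0` in all gauges around `p`: no smooth gauge transformation, on any open neighbourhood of
`p`, makes the gauge field vanish identically there. -/
def NeZeroInAllGauges (p : M) : Prop :=
  ∀ (U : Set M) (Ω : M → Matrix (Fin n) (Fin n) ℂ), IsOpen U → p ∈ U →
    (∀ q ∈ U, Ω q ∈ K.group n) →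
    (∀ a b, ContMDiffOn (𝓡 d) 𝓘(ℝ, ℂ) ∞ (fun q => Ω q a b) U) →
    ∃ q ∈ U, ∃ v, A.transform c Ω q v ≠ 0

end GaugeField

end Manifolds

end GeomInteraction

end

/-!
Both equivalences rest on one integrability theorem. Given matrices `M_i` on an open subset of
`ℝ^d` whose curvature `∂_i M_j - ∂_j M_i + [M_i, M_j]` vanishes, the overdetermined system
`∂_i E = E M_i` is locally solvable with an arbitrary initial value (`exists_mpd_eq_mul`);
conversely, by symmetry of second derivatives, any solution `E` annihilates the curvature
(`mul_curvature_eq_zero`). For existence, the equation is solved along the rays from the initial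
point. That this radial solution is differentiable with the right derivative is a Grönwall
estimate: the solution along a nearby ray is compared with the first-order correction that the
system predicts, and vanishing of the curvature makes the discrepancy quadratic.

For a metric, the system is applied to the prolonged unknown `(φ, dφ)`, with the Christoffel symbols
as coefficients; the torsion-free symmetry of `Γ` and the vanishing of the Riemann tensor are
exactly its integrability. The resulting functions `φ^a` have parallel differentials, so the
pairings `g⁻¹(dφ^a, dφ^b)` are constant. With initial values adapted to the signature they equal
`η`, which makes the Jacobian matrix invertible, makes `φ` a coordinate system, and makes the
components of `g` in it equal to `η` (`Metric.exists_comp_eq_eta`). Conversely, if `g` has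
components `η` near a point in some coordinates, the Jacobian matrix `J` of the change to them
satisfies `∂_i J = J Γ_i` in any other coordinates, so that the curvature vanishes there
(`Metric.riemann_eq_zero_of_comp_eq_eta`). The pointwise equivalence follows since `Γ = 0` on a
coordinate domain implies `R = 0` there.

For a gauge field, a gauge transformation `Ω` takes `A` to zero precisely when
`∂_i Ω = i c Ω A_i`, a system whose curvature is `i c F`. The solution with initial value `1`
stays in the gauge group because `A` is Hermitian (and trace-free for `SU(n)`, by Jacobi's formula),
and the columns of `Ω⁻¹` form a parallel frame. A parallel frame in turn solves the transposed
system, which forces `F = 0`.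
-/

noncomputable section

namespace GeomInteraction

/-! ### Total differential systems with vanishing curvature -/

section LinearSystems

set_option maxSynthPendingDepth 3

variable {X V : Type*} [NormedAddCommGroup X] [NormedSpace ℝ X]
  [NormedAddCommGroup V] [NormedSpace ℝ V]

theorem exists_hasDerivWithinAt_linear [CompleteSpace V] (a : ℝ → V →L[ℝ] V)
    (hc : ContinuousOn a (Icc 0 1)) (hb : ∀ t ∈ Icc (0 : ℝ) 1, ‖a t‖ ≤ 1 / 2) (u₀ : V) :
    ∃ u : ℝ → V, u 0 = u₀ ∧
      ∀ t ∈ Icc (0 : ℝ) 1, HasDerivWithinAt u (a t (u t)) (Icc 0 1) t := by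
  have hz : (0 : ℝ) ∈ Icc (0 : ℝ) 1 := by simp
  -- On the ball of radius `‖u₀‖` around `u₀` the speed is at most `1 / 2 * (2 * ‖u₀‖) = ‖u₀‖`, so
  -- that a solution cannot leave it before time `1`.
  have hP : IsPicardLindelof (fun t u => a t u) (⟨0, hz⟩ : Icc (0 : ℝ) 1) u₀ ‖u₀‖₊ 0 ‖u₀‖₊ 1 := by
    refine ⟨fun t ht => ?_, fun x _ => ?_, fun t ht x hx => ?_, ?_⟩
    · refine LipschitzWith.lipschitzOnWith ?_
      refine (a t).lipschitz.weaken ?_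
      rw [← NNReal.coe_le_coe]
      simpa using (hb t ht).trans (by norm_num)
    · exact hc.clm_apply continuousOn_const
    · have h1 : ‖x‖ ≤ 2 * ‖u₀‖ := by
        have : ‖x - u₀‖ ≤ ‖u₀‖ := by simpa [dist_eq_norm] using hx
        have := norm_le_insert' x u₀
        linarith
      calc ‖a t x‖ ≤ ‖a t‖ * ‖x‖ := (a t).le_opNorm x
        _ ≤ 1 / 2 * (2 * ‖u₀‖) := by gcongr; exact hb t ht
        _ = ‖u₀‖ := by ring
    · simp
  simpa using hP.exists_eq_forall_mem_Icc_hasDerivWithinAt₀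

/-- Along a ray from the origin, a solution `U` for the endpoint `x` becomes, after adding the
first-order correction `t • θ (t • x) h (U t)`, an approximate solution for the endpoint `x + h`
with an error that is quadratic in `h`; vanishing curvature `flat` cancels the linear terms. -/
theorem norm_radial_error_le {A A₂ : X →L[ℝ] V →L[ℝ] V} {D : X →L[ℝ] X →L[ℝ] V →L[ℝ] V}
    {x h : X} {t B B' K r N : ℝ} {u : V} (ht : t ∈ Icc (0 : ℝ) 1)
    (hA : ‖A‖ ≤ B) (hD : ‖D‖ ≤ B') (hA₂ : ‖A₂ - A - t • D h‖ ≤ K * ‖h‖ ^ 2)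
    (hx : ‖x + h‖ ≤ r) (hh : ‖h‖ ≤ 2 * r) (hu : ‖u‖ ≤ N)
    (flat : D x h + A h ∘L A x = D h x + A x ∘L A h) :
    ‖A x u + (A h u + t • (D x h u + A h (A x u))) - A₂ (x + h) (u + t • A h u)‖ ≤
      (B * B * N + B' * r * (B * N) + B' * N + K * r * (N + B * (2 * r) * N)) * ‖h‖ ^ 2 := by
  have hflat := congrArg (fun T => T u) flat
  simp only [add_apply, ContinuousLinearMap.comp_apply] at hflat
  set ρ := A₂ - A - t • D h with hρ
  have hA₂' : A₂ = A + t • D h + ρ := by rw [hρ]; abel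
  have key : A x u + (A h u + t • (D x h u + A h (A x u))) - A₂ (x + h) (u + t • A h u) =
      -(t • A h (A h u) + (t * t) • D h (x + h) (A h u) + t • D h h u
        + ρ (x + h) (u + t • A h u)) := by
    rw [hA₂', hflat]
    simp only [add_apply, map_add, smul_apply, map_smul,
      smul_add, smul_smul]
    abel
  have hB : 0 ≤ B := (norm_nonneg _).trans hA
  have hB' : 0 ≤ B' := (norm_nonneg _).trans hD
  have hN : 0 ≤ N := (norm_nonneg _).trans hu
  have hr : 0 ≤ r := (norm_nonneg _).trans hx
  have ht1 : ‖t‖ ≤ 1 := by rw [Real.norm_eq_abs, abs_le]; constructor <;> linarith [ht.1, ht.2]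
  have hAh : ∀ w, ‖A h w‖ ≤ B * ‖h‖ * ‖w‖ := fun w =>
    (A.le_opNorm₂ h w).trans (by gcongr)
  have hDh : ∀ y w, ‖D h y w‖ ≤ B' * ‖h‖ * ‖y‖ * ‖w‖ := fun y w =>
    ((D h).le_opNorm₂ y w).trans (by gcongr; exact (D.le_opNorm h).trans (by gcongr))
  have e1 : ‖t • A h (A h u)‖ ≤ B * B * N * ‖h‖ ^ 2 := by
    calc ‖t • A h (A h u)‖ ≤ 1 * (B * ‖h‖ * (B * ‖h‖ * N)) := by
          rw [norm_smul]; gcongr; exact (hAh _).trans (by gcongr; exact (hAh _).trans (by gcongr))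
      _ = _ := by ring
  have e2 : ‖(t * t) • D h (x + h) (A h u)‖ ≤ B' * r * (B * N) * ‖h‖ ^ 2 := by
    calc ‖(t * t) • D h (x + h) (A h u)‖ ≤ (1 * 1) * (B' * ‖h‖ * r * (B * ‖h‖ * N)) := by
          rw [norm_smul, norm_mul]; gcongr
          exact (hDh _ _).trans (by gcongr; exact (hAh _).trans (by gcongr))
      _ = _ := by ring
  have e3 : ‖t • D h h u‖ ≤ B' * N * ‖h‖ ^ 2 := by
    calc ‖t • D h h u‖ ≤ 1 * (B' * ‖h‖ * ‖h‖ * N) := by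
          rw [norm_smul]; gcongr; exact (hDh _ _).trans (by gcongr)
      _ = _ := by ring
  have e4 : ‖ρ (x + h) (u + t • A h u)‖ ≤ K * r * (N + B * (2 * r) * N) * ‖h‖ ^ 2 := by
    have : ‖u + t • A h u‖ ≤ N + B * (2 * r) * N := by
      refine (norm_add_le _ _).trans (add_le_add hu ?_)
      calc ‖t • A h u‖ ≤ 1 * (B * (2 * r) * N) := by
            rw [norm_smul]; gcongr; exact (hAh _).trans (by gcongr)
        _ = _ := by ring
    calc ‖ρ (x + h) (u + t • A h u)‖ ≤ ‖ρ‖ * ‖x + h‖ * ‖u + t • A h u‖ := ρ.le_opNorm₂ _ _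
      _ ≤ (K * ‖h‖ ^ 2) * r * (N + B * (2 * r) * N) := by
          have := (norm_nonneg _).trans hA₂
          gcongr
      _ = _ := by ring
  rw [key, norm_neg]
  refine (norm_add_le _ _).trans ((add_le_add norm_add₃_le le_rfl).trans ?_)
  linarith

/-- The Frobenius theorem around the origin, with explicit bounds for the coefficients: on a ball so
small that the coefficient of the equation `U' = θ (t • x) x U` along each ray is at most `1 / 2`,
the end value `S x = U 1` of its solution with `U 0 = S₀` solves `dS = θ S`. -/
theorem exists_hasFDerivAt_of_flat_aux [CompleteSpace V] {θ : X → X →L[ℝ] V →L[ℝ] V}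
    {D : X → X →L[ℝ] X →L[ℝ] V →L[ℝ] V} {r B B' K : ℝ} (hr : 0 < r) (hK : 0 ≤ K)
    (hθ : ∀ x ∈ Metric.ball (0 : X) r, HasFDerivAt θ (D x) x)
    (hB : ∀ x ∈ Metric.ball (0 : X) r, ‖θ x‖ ≤ B) (hB' : ∀ x ∈ Metric.ball (0 : X) r, ‖D x‖ ≤ B')
    (hD : ∀ x ∈ Metric.ball (0 : X) r, ∀ y ∈ Metric.ball (0 : X) r, ‖D y - D x‖ ≤ K * ‖y - x‖)
    (hsmall : B * r ≤ 1 / 2)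
    (flat : ∀ x ∈ Metric.ball (0 : X) r, ∀ v w,
      D x v w + θ x w ∘L θ x v = D x w v + θ x v ∘L θ x w) (S₀ : V) :
    ∃ S : X → V, S 0 = S₀ ∧ ∀ x ∈ Metric.ball (0 : X) r, HasFDerivAt S ((θ x).flip (S x)) x := by
  have hB0 : 0 ≤ B := (norm_nonneg _).trans (hB 0 (by simpa))
  have hB'0 : 0 ≤ B' := (norm_nonneg _).trans (hB' 0 (by simpa))
  have hmem : ∀ x ∈ Metric.ball (0 : X) r, ∀ t ∈ Icc (0 : ℝ) 1, t • x ∈ Metric.ball (0 : X) r := by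
    intro x hx t ht
    rw [mem_ball_zero_iff] at hx ⊢
    rw [norm_smul, Real.norm_eq_abs, abs_of_nonneg ht.1]
    nlinarith [ht.2, norm_nonneg x]
  have hray : ∀ x ∈ Metric.ball (0 : X) r, ∀ t ∈ Icc (0 : ℝ) 1,
      HasDerivAt (fun t : ℝ => θ (t • x)) (D (t • x) x) t := by
    intro x hx t ht
    have h1 : HasDerivAt (fun t : ℝ => t • x) x t := by
      simpa using (hasDerivAt_id t).smul_const x
    exact (hθ _ (hmem x hx t ht)).comp_hasDerivAt t h1
  have hbound : ∀ x ∈ Metric.ball (0 : X) r, ∀ t ∈ Icc (0 : ℝ) 1, ‖θ (t • x) x‖ ≤ 1 / 2 := by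
    intro x hx t ht
    have hx' := (mem_ball_zero_iff.1 hx).le
    exact ((θ (t • x)).le_opNorm x).trans
      ((mul_le_mul (hB _ (hmem x hx t ht)) hx' (norm_nonneg _) hB0).trans hsmall)
  have hex : ∀ x : X, ∃ u : ℝ → V, u 0 = S₀ ∧ (x ∈ Metric.ball (0 : X) r →
      ∀ t ∈ Icc (0 : ℝ) 1, HasDerivWithinAt u (θ (t • x) x (u t)) (Icc 0 1) t) := by
    intro x
    by_cases hx : x ∈ Metric.ball (0 : X) r
    · obtain ⟨u, h0, hu⟩ := exists_hasDerivWithinAt_linear (fun t => θ (t • x) x)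
        (fun t ht => ((hray x hx t ht).continuousAt.clm_apply
          continuousAt_const).continuousWithinAt) (hbound x hx) S₀
      exact ⟨u, h0, fun _ => hu⟩
    · exact ⟨fun _ => S₀, rfl, fun h => absurd h hx⟩
  choose U hU0 hU using hex
  have hUr : ∀ x ∈ Metric.ball (0 : X) r, ∀ t ∈ Ico (0 : ℝ) 1,
      HasDerivWithinAt (U x) (θ (t • x) x (U x t)) (Ici t) t := fun x hx t ht =>
    (hU x hx t (Ico_subset_Icc_self ht)).mono_of_mem_nhdsWithin (Icc_mem_nhdsGE_of_mem ht)
  have hUc : ∀ x ∈ Metric.ball (0 : X) r, ContinuousOn (U x) (Icc 0 1) := fun x hx t ht =>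
    (hU x hx t ht).continuousWithinAt
  refine ⟨fun x => U x 1, ?_, fun x hx => ?_⟩
  · have h0 : (0 : X) ∈ Metric.ball (0 : X) r := by simpa
    have := constant_of_derivWithin_zero (f := U 0) (a := 0) (b := 1)
      (fun t ht => (hU 0 h0 t ht).differentiableWithinAt)
      (fun t ht => by
        have h := hU 0 h0 t (Ico_subset_Icc_self ht)
        rw [h.derivWithin (uniqueDiffOn_Icc one_pos t (Ico_subset_Icc_self ht))]
        simp) 1 (by simp)
    simpa [hU0] using this
  obtain ⟨N, hN⟩ := isCompact_Icc.exists_bound_of_continuousOn (hUc x hx)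
  set C := B * B * N + B' * r * (B * N) + B' * N + K * r * (N + B * (2 * r) * N) with hC
  have main : ∀ h : X, x + h ∈ Metric.ball (0 : X) r →
      ‖U (x + h) 1 - U x 1 - θ x h (U x 1)‖ ≤ (C * (Real.exp 1 - 1)) * ‖h‖ ^ 2 := by
    intro h hxh
    have hxn := (mem_ball_zero_iff.1 hx).le
    have hxhn := (mem_ball_zero_iff.1 hxh).le
    have hh : ‖h‖ ≤ 2 * r := by
      have : h = (x + h) - x := by abel
      rw [this]
      exact (norm_sub_le _ _).trans (by linarith)
    have hQ : ∀ t ∈ Icc (0 : ℝ) 1, ∀ s : Set ℝ,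
        HasDerivWithinAt (U x) (θ (t • x) x (U x t)) s t →
        HasDerivWithinAt (fun t => U x t + t • θ (t • x) h (U x t))
          (θ (t • x) x (U x t) + (θ (t • x) h (U x t) +
            t • (D (t • x) x h (U x t) + θ (t • x) h (θ (t • x) x (U x t))))) s t := by
      intro t ht s hs
      have h1 : HasDerivWithinAt (fun t => θ (t • x) h) (D (t • x) x h) s t := by
        simpa using ((hray x hx t ht).hasDerivWithinAt (s := s)).clm_apply
          (hasDerivWithinAt_const t s h)
      have h2 := h1.clm_apply hs
      have h3 := hs.fun_add (((hasDerivAt_id' t).hasDerivWithinAt (s := s)).fun_smul h2)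
      rw [one_smul, add_comm (t • _)] at h3
      exact h3
    have hG := dist_le_of_approx_trajectories_ODE_of_mem (K := 1) (a := 0) (b := 1) (δ := 0)
      (εf := 0) (εg := C * ‖h‖ ^ 2) (s := fun _ => univ)
      (v := fun t u => θ (t • (x + h)) (x + h) u)
      (f := U (x + h)) (g := fun t => U x t + t • θ (t • x) h (U x t))
      (fun t ht => by
        refine LipschitzWith.lipschitzOnWith ?_
        refine (θ (t • (x + h)) (x + h)).lipschitz.weaken ?_
        rw [← NNReal.coe_le_coe]
        simpa using (hbound _ hxh t (Ico_subset_Icc_self ht)).trans (by norm_num))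
      (hUc _ hxh) (hUr _ hxh) (fun t _ => by simp) (fun _ _ => trivial)
      (fun t ht => (hQ t ht _ (hU x hx t ht)).continuousWithinAt)
      (fun t ht => hQ t (Ico_subset_Icc_self ht) _ (hUr x hx t ht))
      (fun t ht => by
        have ht' := Ico_subset_Icc_self ht
        have hm := hmem x hx t ht'
        have hm2 := hmem _ hxh t ht'
        rw [dist_eq_norm]
        refine norm_radial_error_le ht' (hB _ hm) (hB' _ hm) ?_ hxhn hh (hN t ht') (flat _ hm x h)
        have hth : t • (x + h) - t • x = t • h := by rw [smul_add]; abel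
        have hthn : ‖t • h‖ ≤ ‖h‖ := by
          rw [norm_smul, Real.norm_eq_abs, abs_of_nonneg ht'.1]
          nlinarith [ht'.2, norm_nonneg h]
        have hseg : segment ℝ (t • x) (t • (x + h)) ⊆ Metric.ball (0 : X) r :=
          (convex_ball _ _).segment_subset hm hm2
        have := (convex_segment (t • x) (t • (x + h))).norm_image_sub_le_of_norm_hasFDerivWithin_le'
          (f := θ) (f' := D) (φ := D (t • x)) (C := K * ‖h‖)
          (fun z hz => (hθ z (hseg hz)).hasFDerivWithinAt)
          (fun z hz => (hD _ hm z (hseg hz)).trans (by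
            gcongr
            have := norm_sub_le_of_mem_segment hz
            rw [hth] at this
            exact this.trans hthn))
          (left_mem_segment ℝ _ _) (right_mem_segment ℝ _ _)
        rw [hth, map_smul] at this
        refine this.trans ?_
        rw [mul_assoc, sq]
        gcongr)
      (fun _ _ => trivial) (by simp [hU0]) 1 (by simp)
    rw [dist_eq_norm, gronwallBound_of_K_ne_0 (by simp)] at hG
    simp only [one_smul, NNReal.coe_one, zero_mul, zero_add, div_one, one_mul, sub_zero] at hG
    calc _ = ‖U (x + h) 1 - (U x 1 + θ x h (U x 1))‖ := by rw [sub_add_eq_sub_sub]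
      _ ≤ _ := hG
      _ = _ := by ring
  rw [hasFDerivAt_iff_isLittleO_nhds_zero]
  have hO : (fun h => U (x + h) 1 - U x 1 - (θ x).flip (U x 1) h) =O[𝓝 0]
      fun h => ‖h‖ ^ 2 := by
    refine Asymptotics.IsBigO.of_bound (C * (Real.exp 1 - 1)) ?_
    have : ∀ᶠ h : X in 𝓝 0, x + h ∈ Metric.ball (0 : X) r := by
      have hc : ContinuousAt (fun h : X => x + h) 0 := by fun_prop
      exact hc.eventually (by simpa only [add_zero] using Metric.isOpen_ball.eventually_mem hx)
    filter_upwards [this] with h hh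
    simpa using main h hh
  exact hO.trans_isLittleO (Asymptotics.isLittleO_norm_pow_id one_lt_two)

/-- **Frobenius theorem** for the linear total differential system `dS = θ S`: if the coefficients
satisfy the integrability condition `flat` near `x₀`, there is a ball around `x₀` on which it is
solvable with every initial value. -/
theorem exists_hasFDerivAt_of_flat [CompleteSpace V] {θ : X → X →L[ℝ] V →L[ℝ] V} {x₀ : X}
    (hθ : ContDiffAt ℝ 2 θ x₀)
    (flat : ∀ᶠ x in 𝓝 x₀, ∀ v w, fderiv ℝ θ x v w + θ x w ∘L θ x v =
      fderiv ℝ θ x w v + θ x v ∘L θ x w) {W : Set X} (hW : W ∈ 𝓝 x₀) :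
    ∃ r > 0, Metric.ball x₀ r ⊆ W ∧ ∀ S₀ : V, ∃ S : X → V, S x₀ = S₀ ∧
      ∀ x ∈ Metric.ball x₀ r, HasFDerivAt S ((θ x).flip (S x)) x := by
  have hdiff : ∀ᶠ x in 𝓝 x₀, DifferentiableAt ℝ θ x := by
    filter_upwards [hθ.eventually (by simp)] with x hx
    exact hx.differentiableAt (by simp)
  have hD : ContDiffAt ℝ 1 (fderiv ℝ θ) x₀ := hθ.fderiv_right (by norm_num)
  obtain ⟨K, T, hT, hK⟩ := hD.exists_lipschitzOnWith
  have hb : ∀ᶠ x in 𝓝 x₀, ‖θ x‖ ≤ ‖θ x₀‖ + 1 := by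
    filter_upwards [hθ.continuousAt.norm.eventually (gt_mem_nhds (lt_add_one ‖θ x₀‖))] with x hx
    exact hx.le
  have hb' : ∀ᶠ x in 𝓝 x₀, ‖fderiv ℝ θ x‖ ≤ ‖fderiv ℝ θ x₀‖ + 1 := by
    filter_upwards [hD.continuousAt.norm.eventually
      (gt_mem_nhds (lt_add_one ‖fderiv ℝ θ x₀‖))] with x hx
    exact hx.le
  obtain ⟨r₀, hr₀, hball⟩ := Metric.eventually_nhds_iff_ball.1
    (hdiff.and (hb.and (hb'.and (flat.and (Filter.Eventually.and hT hW)))))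
  set B := ‖θ x₀‖ + 1 with hBdef
  have hBpos : 0 < B := by positivity
  -- With `r ≤ 1 / (2 * B)` the coefficient `θ (t • x) x` of the radial equation is at most `1 / 2`.
  set r := min r₀ (1 / (2 * B)) with hrdef
  have hr : 0 < r := lt_min hr₀ (by positivity)
  have hsub : ∀ y ∈ Metric.ball (0 : X) r, x₀ + y ∈ Metric.ball x₀ r₀ := by
    intro y hy
    rw [mem_ball_zero_iff] at hy
    simpa using hy.trans_le (min_le_left _ _)
  refine ⟨r, hr, fun x hx => (hball x (Metric.ball_subset_ball (min_le_left _ _) hx)).2.2.2.2.2,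
    fun S₀ => ?_⟩
  obtain ⟨S, hS0, hS⟩ := exists_hasFDerivAt_of_flat_aux (θ := fun y => θ (x₀ + y))
    (D := fun y => fderiv ℝ θ (x₀ + y)) (r := r) (B := B) (B' := ‖fderiv ℝ θ x₀‖ + 1) (K := K) hr
    K.2 (fun y hy => by
      exact (hball _ (hsub y hy)).1.hasFDerivAt.comp y ((hasFDerivAt_id y).const_add x₀))
    (fun y hy => (hball _ (hsub y hy)).2.1) (fun y hy => (hball _ (hsub y hy)).2.2.1)
    (fun y hy z hz => by
      have := hK.norm_sub_le (hball _ (hsub z hz)).2.2.2.2.1 (hball _ (hsub y hy)).2.2.2.2.1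
      simpa using this)
    (by
      calc B * r ≤ B * (1 / (2 * B)) := by gcongr; exact min_le_right _ _
        _ = 1 / 2 := by field_simp)
    (fun y hy => (hball _ (hsub y hy)).2.2.2.1) S₀
  refine ⟨fun x => S (x - x₀), by simpa using hS0, fun x hx => ?_⟩
  have hx' : x - x₀ ∈ Metric.ball (0 : X) r := by
    rw [mem_ball_zero_iff, ← dist_eq_norm]; exact hx
  have h1 := (hS _ hx').comp x ((hasFDerivAt_id x).sub_const x₀)
  rw [add_sub_cancel] at h1
  exact h1

/-- Solutions of a smooth total differential system are smooth. -/
theorem contDiffOn_of_hasFDerivAt_clm {θ : X → X →L[ℝ] V →L[ℝ] V} {S : X → V} {W : Set X}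
    (hW : IsOpen W) (hθ : ContDiffOn ℝ ∞ θ W)
    (hS : ∀ x ∈ W, HasFDerivAt S ((θ x).flip (S x)) x) : ContDiffOn ℝ ∞ S W := by
  rw [contDiffOn_infty]
  intro n
  induction n with
  | zero =>
    exact contDiffOn_zero.2 fun x hx => (hS x hx).continuousAt.continuousWithinAt
  | succ n ih =>
    push_cast
    rw [contDiffOn_succ_iff_fderiv_of_isOpen hW]
    refine ⟨fun x hx => (hS x hx).differentiableAt.differentiableWithinAt, by simp, ?_⟩
    refine ContDiffOn.congr (f := fun x => (θ x).flip (S x)) ?_ fun x hx => (hS x hx).fderiv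
    have h1 : ContDiffOn ℝ n (fun x => (θ x).flip) W :=
      (ContinuousLinearMap.flipₗᵢ ℝ X V V).toContinuousLinearEquiv.contDiff.comp_contDiffOn
        (hθ.of_le (by exact_mod_cast le_top))
    exact h1.clm_apply ih

end LinearSystems

/-! ### Systems of linear equations for matrix-valued functions -/

section MatrixSystems

set_option maxSynthPendingDepth 3

variable {d : ℕ} {𝕜 : Type*} [NormedField 𝕜] [NormedAlgebra ℝ 𝕜]
  {ι κ μ : Type*}

theorem fderiv_eq_sum_pd {F : Type*} [NormedAddCommGroup F] [NormedSpace ℝ F]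
    (f : Coord d → F) (x v : Coord d) : fderiv ℝ f x v = ∑ i, v i • pd i f x := by
  have hv : v = ∑ i, v i • EuclideanSpace.single i (1 : ℝ) := by
    have := (EuclideanSpace.basisFun (Fin d) ℝ).sum_repr v
    simpa using this.symm
  conv_lhs => rw [hv]
  simp [pd, map_sum]

theorem pd_comm {F : Type*} [NormedAddCommGroup F] [NormedSpace ℝ F]
    {f : Coord d → F} {x : Coord d} (hf : ContDiffAt ℝ 2 f x) (i j : Fin d) :
    pd i (pd j f) x = pd j (pd i f) x := by
  have hd : DifferentiableAt ℝ (fderiv ℝ f) x :=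
    (hf.fderiv_right (m := 1) (by norm_num)).differentiableAt (by simp)
  have key : ∀ k l : Fin d, pd k (pd l f) x =
      fderiv ℝ (fderiv ℝ f) x (EuclideanSpace.single k 1) (EuclideanSpace.single l 1) := by
    intro k l
    unfold pd
    rw [fderiv_clm_apply hd (differentiableAt_const _)]
    simp
  rw [key, key]
  exact hf.isSymmSndFDerivAt (by simp) _ _

theorem contDiffOn_pd {F : Type*} [NormedAddCommGroup F] [NormedSpace ℝ F]
    {f : Coord d → F} {W : Set (Coord d)} (hW : IsOpen W) (hf : ContDiffOn ℝ ∞ f W) (i : Fin d) :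
    ContDiffOn ℝ ∞ (pd i f) W :=
  ((hf.fderiv_of_isOpen hW (m := ∞) (by simp)).clm_apply contDiffOn_const)

theorem pd_congr {F : Type*} [NormedAddCommGroup F] [NormedSpace ℝ F]
    {f f' : Coord d → F} {x : Coord d} (h : f =ᶠ[𝓝 x] f') (i : Fin d) : pd i f x = pd i f' x := by
  unfold pd; rw [h.fderiv_eq]

/-- The entrywise partial derivative `∂F/∂x^i` of a matrix-valued function of the coordinates. -/
def mpd (i : Fin d) (F : Coord d → Matrix κ ι 𝕜) (x : Coord d) : Matrix κ ι 𝕜 :=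
  Matrix.of fun a b => pd i (fun y => F y a b) x

theorem mpd_apply (i : Fin d) (F : Coord d → Matrix κ ι 𝕜) (x : Coord d) (a : κ) (b : ι) :
    mpd i F x a b = pd i (fun y => F y a b) x := rfl

theorem mpd_mul [Fintype ι] {F : Coord d → Matrix κ ι 𝕜} {G : Coord d → Matrix ι μ 𝕜} {x : Coord d}
    (hF : ∀ a b, DifferentiableAt ℝ (fun y => F y a b) x)
    (hG : ∀ a b, DifferentiableAt ℝ (fun y => G y a b) x) (i : Fin d) :
    mpd i (fun y => F y * G y) x = mpd i F x * G x + F x * mpd i G x := by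
  ext a b
  simp only [mpd_apply, Matrix.add_apply, Matrix.mul_apply, pd]
  rw [fderiv_fun_sum fun k _ => (hF a k).fun_mul (hG k b)]
  simp only [FunLike.coe_sum, Finset.sum_apply]
  rw [← Finset.sum_add_distrib]
  refine Finset.sum_congr rfl fun k _ => ?_
  rw [fderiv_fun_mul (hF a k) (hG k b)]
  simp
  ring

theorem mpd_congr {F G : Coord d → Matrix κ ι 𝕜} {x : Coord d} (h : ∀ᶠ y in 𝓝 x, F y = G y)
    (i : Fin d) : mpd i F x = mpd i G x := by
  ext a b
  exact pd_congr (h.mono fun y hy => by rw [hy]) i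

theorem mpd_const (C : Matrix κ ι 𝕜) (x : Coord d) (i : Fin d) :
    mpd i (fun _ => C) x = 0 := by
  ext a b; simp [mpd_apply, pd]

theorem mpd_transpose (F : Coord d → Matrix κ ι 𝕜) (x : Coord d) (i : Fin d) :
    mpd i (fun y => (F y).transpose) x = (mpd i F x).transpose := rfl

theorem mpd_const_mul [Fintype ι] {F : Coord d → Matrix ι μ 𝕜} {x : Coord d} (C : Matrix κ ι 𝕜)
    (hF : ∀ a b, DifferentiableAt ℝ (fun y => F y a b) x) (i : Fin d) :
    mpd i (fun y => C * F y) x = C * mpd i F x := by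
  rw [mpd_mul (F := fun _ => C) (fun _ _ => differentiableAt_const _) hF, mpd_const, Matrix.zero_mul,
    zero_add]

theorem mpd_const_smul (c : 𝕜) (F : Coord d → Matrix κ ι 𝕜) (x : Coord d)
    (hF : ∀ a b, DifferentiableAt ℝ (fun y => F y a b) x) (i : Fin d) :
    mpd i (fun y => c • F y) x = c • mpd i F x := by
  ext a b
  simp only [mpd_apply, Matrix.smul_apply, pd]
  rw [fderiv_fun_const_smul (hF a b)]
  rfl

theorem eq_of_pd_eq_zero {f : Coord d → 𝕜} {x₀ : Coord d} {r : ℝ}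
    (hf : ∀ x ∈ Metric.ball x₀ r, DifferentiableAt ℝ f x)
    (h : ∀ x ∈ Metric.ball x₀ r, ∀ i, pd i f x = 0) {x : Coord d} (hx : x ∈ Metric.ball x₀ r) :
    f x = f x₀ := by
  refine Metric.isOpen_ball.is_const_of_fderiv_eq_zero (𝕜 := ℝ) (f := f)
    (convex_ball x₀ r).isPreconnected (fun y hy => (hf y hy).differentiableWithinAt)
    (fun y hy => ?_) hx (Metric.mem_ball_self (Metric.pos_of_mem_ball hx))
  ext v
  simp [fderiv_eq_sum_pd, h y hy]

theorem eq_of_mpd_eq_zero {F : Coord d → Matrix κ ι 𝕜} {x₀ : Coord d} {r : ℝ}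
    (hF : ∀ x ∈ Metric.ball x₀ r, ∀ a b, DifferentiableAt ℝ (fun y => F y a b) x)
    (h : ∀ x ∈ Metric.ball x₀ r, ∀ i, mpd i F x = 0) {x : Coord d} (hx : x ∈ Metric.ball x₀ r) :
    F x = F x₀ := by
  ext a b
  refine eq_of_pd_eq_zero (f := fun y => F y a b) (fun y hy => hF y hy a b) (fun y hy i => ?_) hx
  rw [← mpd_apply, h y hy]
  rfl

/-- A solution `E` of `∂_i E = E M_i` annihilates the curvature of `M`, by symmetry of second
derivatives. No invertibility of `E` is needed, and `E` need not be square. -/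
theorem mul_curvature_eq_zero [Fintype ι] {M : Fin d → Coord d → Matrix ι ι 𝕜}
    {E : Coord d → Matrix κ ι 𝕜} {x : Coord d} (hE : ∀ a b, ContDiffAt ℝ 2 (fun y => E y a b) x)
    (hM : ∀ i a b, DifferentiableAt ℝ (fun y => M i y a b) x)
    (h : ∀ᶠ y in 𝓝 x, ∀ i, mpd i E y = E y * M i y) (i j : Fin d) :
    E x * (mpd i (M j) x - mpd j (M i) x + M i x * M j x - M j x * M i x) = 0 := by
  have hEd : ∀ a b, DifferentiableAt ℝ (fun y => E y a b) x := fun a b =>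
    (hE a b).differentiableAt (by simp)
  have key : ∀ k l, mpd k (mpd l E) x = E x * M k x * M l x + E x * mpd k (M l) x := by
    intro k l
    rw [mpd_congr (h.mono fun y hy => hy l), mpd_mul hEd (hM l), h.self_of_nhds k]
  have hs : mpd i (mpd j E) x = mpd j (mpd i E) x := by
    ext a b
    exact pd_comm (hE a b) i j
  rw [key, key] at hs
  rw [← sub_eq_zero] at hs
  rw [← hs]
  simp only [Matrix.mul_sub, Matrix.mul_add, Matrix.mul_assoc]
  abel

/-- The coefficient `v ↦ (u ↦ u ∑ v^i N_i)` of the system `∂_i u = u N_i` on row vectors, as a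
linear function of the matrices `N_i`. -/
def rowSystem (d : ℕ) (𝕜 ι : Type*) [NormedField 𝕜] [NormedAlgebra ℝ 𝕜] [Fintype ι]
    [FiniteDimensional ℝ 𝕜] :
    (Fin d → ι → ι → 𝕜) →ₗ[ℝ] (Coord d →L[ℝ] (ι → 𝕜) →L[ℝ] (ι → 𝕜)) where
  toFun N := ∑ i, (EuclideanSpace.proj i : Coord d →L[ℝ] ℝ).smulRight
    (LinearMap.toContinuousLinearMap ((Matrix.vecMulLinear (Matrix.of (N i))).restrictScalars ℝ))
  map_add' N N' := by
    ext v u b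
    simp [Matrix.vecMul, dotProduct, mul_add, Finset.sum_add_distrib]
  map_smul' c N := by
    ext v u b
    simp [Matrix.vecMul, dotProduct, Finset.smul_sum, smul_comm c]

theorem rowSystem_apply [Fintype ι] [FiniteDimensional ℝ 𝕜] (N : Fin d → ι → ι → 𝕜)
    (v : Coord d) (u : ι → 𝕜) :
    rowSystem d 𝕜 ι N v u = Matrix.vecMul u (∑ i, v i • Matrix.of (N i)) := by
  ext b
  simp [rowSystem, Matrix.vecMul, dotProduct, Matrix.sum_apply, Finset.mul_sum, Finset.smul_sum]
  rw [Finset.sum_comm]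

/-- The bilinear identity behind integrability of the system `∂_i u = u M_i`. -/
theorem flat_bilinear [Fintype ι] {P : Fin d → Fin d → Matrix ι ι 𝕜} {M : Fin d → Matrix ι ι 𝕜}
    (h : ∀ i j, P i j - P j i + M i * M j - M j * M i = 0) (v w : Coord d) :
    ∑ i, w i • (∑ j, v j • P j i) + (∑ j, v j • M j) * (∑ i, w i • M i) =
      ∑ i, v i • (∑ j, w j • P j i) + (∑ j, w j • M j) * (∑ i, v i • M i) := by
  have hs : ∀ i j, P i j + M i * M j = P j i + M j * M i := fun i j => by
    rw [← sub_eq_zero, ← h i j]; abel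
  have e1 : ∀ a b : Coord d,
      ∑ i, b i • (∑ j, a j • P j i) + (∑ j, a j • M j) * (∑ i, b i • M i) =
        ∑ i, ∑ j, (b i * a j) • (P j i + M j * M i) := by
    intro a b
    rw [Finset.sum_mul_sum, Finset.sum_comm (f := fun j i => (a j • M j) * (b i • M i)),
      ← Finset.sum_add_distrib]
    refine Finset.sum_congr rfl fun i _ => ?_
    rw [Finset.smul_sum, ← Finset.sum_add_distrib]
    refine Finset.sum_congr rfl fun j _ => ?_
    rw [smul_add, smul_smul, smul_mul_smul_comm, mul_comm (a j)]
  rw [e1, e1, Finset.sum_comm]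
  refine Finset.sum_congr rfl fun i _ => Finset.sum_congr rfl fun j _ => ?_
  rw [hs, mul_comm]

/-- **Frobenius theorem** for a matrix system: if the curvature of `M` vanishes on the open set
`W ∋ x₀`, the system `∂_i E = E M_i` has, on a ball around `x₀`, a smooth solution with any
prescribed value at `x₀`. -/
theorem exists_mpd_eq_mul [Fintype ι] [FiniteDimensional ℝ 𝕜]
    {M : Fin d → Coord d → Matrix ι ι 𝕜} {W : Set (Coord d)}
    (hW : IsOpen W) (hM : ∀ i a b, ContDiffOn ℝ ∞ (fun x => M i x a b) W)
    (flat : ∀ x ∈ W, ∀ i j,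
      mpd i (M j) x - mpd j (M i) x + M i x * M j x - M j x * M i x = 0)
    {x₀ : Coord d} (hx₀ : x₀ ∈ W) :
    ∃ r > 0, Metric.ball x₀ r ⊆ W ∧ ∀ E₀ : Matrix κ ι 𝕜, ∃ E : Coord d → Matrix κ ι 𝕜,
      E x₀ = E₀ ∧ (∀ a b, ContDiffOn ℝ ∞ (fun x => E x a b) (Metric.ball x₀ r)) ∧
      ∀ x ∈ Metric.ball x₀ r, ∀ i, mpd i E x = E x * M i x := by
  have : CompleteSpace 𝕜 := FiniteDimensional.complete ℝ 𝕜
  set Λ : (Fin d → ι → ι → 𝕜) →L[ℝ] (Coord d →L[ℝ] (ι → 𝕜) →L[ℝ] (ι → 𝕜)) :=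
    ⟨rowSystem d 𝕜 ι, LinearMap.continuous_of_finiteDimensional (𝕜 := ℝ) (rowSystem d 𝕜 ι)⟩
  set m : Coord d → (Fin d → ι → ι → 𝕜) := fun x i a b => M i x a b with hm
  have hmd : ContDiffOn ℝ ∞ m W :=
    contDiffOn_pi.2 fun i => contDiffOn_pi.2 fun a => contDiffOn_pi.2 fun b => hM i a b
  set θ : Coord d → Coord d →L[ℝ] (ι → 𝕜) →L[ℝ] (ι → 𝕜) := fun x => Λ (m x) with hθ
  have hθd : ContDiffOn ℝ ∞ θ W := Λ.contDiff.comp_contDiffOn hmd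
  have hθa : ∀ x v u, θ x v u = Matrix.vecMul u (∑ i, v i • M i x) := fun x v u =>
    rowSystem_apply (m x) v u
  have hfd : ∀ x ∈ W, ∀ v w u, fderiv ℝ θ x v w u =
      Matrix.vecMul u (∑ i, w i • (∑ j, v j • mpd j (M i) x)) := by
    intro x hx v w u
    have hdm : DifferentiableAt ℝ m x :=
      (hmd.contDiffAt (hW.mem_nhds hx)).differentiableAt (by simp)
    have h1 : fderiv ℝ θ x v = Λ (fderiv ℝ m x v) := by
      rw [hθ, fderiv_fun_comp x Λ.differentiableAt hdm]
      simp
    rw [h1]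
    refine (rowSystem_apply _ w u).trans ?_
    congr 1
    refine Finset.sum_congr rfl fun i _ => ?_
    congr 1
    ext a b
    have h2 : fderiv ℝ m x v i a b = fderiv ℝ (fun y => M i y a b) x v := by
      have h3 := hasFDerivAt_pi'.1 (hasFDerivAt_pi'.1 (hasFDerivAt_pi'.1 hdm.hasFDerivAt i) a) b
      rw [h3.fderiv]
      rfl
    rw [Matrix.of_apply, h2, fderiv_eq_sum_pd, Matrix.sum_apply]
    rfl
  obtain ⟨r, hr, hrW, hsol⟩ := exists_hasFDerivAt_of_flat (θ := θ) (x₀ := x₀)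
    ((hθd.contDiffAt (hW.mem_nhds hx₀)).of_le ENat.LEInfty.out)
    (by
      filter_upwards [hW.mem_nhds hx₀] with x hx v w
      ext1 u
      simp only [add_apply, ContinuousLinearMap.comp_apply]
      rw [hfd x hx, hfd x hx, hθa, hθa, hθa, hθa, Matrix.vecMul_vecMul, Matrix.vecMul_vecMul,
        ← Matrix.vecMul_add, ← Matrix.vecMul_add]
      congr 1
      exact flat_bilinear (P := fun j i => mpd j (M i) x) (M := fun i => M i x) (flat x hx) v w)
    (hW.mem_nhds hx₀)
  refine ⟨r, hr, hrW, fun E₀ => ?_⟩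
  choose S hS0 hS using fun a => hsol (E₀ a)
  refine ⟨fun x => Matrix.of fun a => S a x, ?_, fun a b => ?_, fun x hx i => ?_⟩
  · ext a b; simp [hS0]
  · exact contDiffOn_pi.1 (contDiffOn_of_hasFDerivAt_clm Metric.isOpen_ball (hθd.mono hrW) (hS a)) b
  · ext a b
    have h3 := hasFDerivAt_pi'.1 (hS a x hx) b
    simp only [mpd_apply, Matrix.of_apply, pd]
    rw [h3.fderiv]
    have h4 : θ x (EuclideanSpace.single i 1) (S a x) = Matrix.vecMul (S a x) (M i x) := by
      rw [hθa]
      congr 1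
      rw [Finset.sum_eq_single i] <;> simp +contextual
    exact congrFun h4 b

end MatrixSystems

/-! ### Coordinate systems and their Jacobian matrices -/

section Charts

variable {d : ℕ} {M : Type*} [TopologicalSpace M] [ChartedSpace (Coord d) M]
  {e e' : OpenPartialHomeomorph M (Coord d)}

theorem IsCoord.mdifferentiable [IsManifold (𝓡 d) ∞ M] (he : IsCoord e) :
    e.MDifferentiable (𝓡 d) (𝓡 d) :=
  ⟨(contMDiffOn_of_mem_maximalAtlas he).mdifferentiableOn (by simp),
    (contMDiffOn_symm_of_mem_maximalAtlas he).mdifferentiableOn (by simp)⟩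

/-- The derivative of `e.symm`, read as an endomorphism of `ℝ^d` through the identification of
every tangent space with the model space. -/
def symmDeriv (e : OpenPartialHomeomorph M (Coord d)) (x : Coord d) : Coord d →L[ℝ] Coord d :=
  mfderiv (𝓡 d) (𝓡 d) e.symm x

/-- The coordinate vector fields at `e.symm x`, as a basis of the model of the tangent space. -/
def coordBasis [IsManifold (𝓡 d) ∞ M] (he : IsCoord e) {x : Coord d} (hx : x ∈ e.target) :
    Module.Basis (Fin d) ℝ (Coord d) :=
  (EuclideanSpace.basisFun (Fin d) ℝ).toBasis.map
    (LinearEquiv.ofBijective (symmDeriv e x).toLinearMap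
      (he.mdifferentiable.symm.mfderiv_bijective hx))

theorem coordBasis_apply [IsManifold (𝓡 d) ∞ M] (he : IsCoord e) {x : Coord d}
    (hx : x ∈ e.target) (i : Fin d) :
    coordBasis he hx i = symmDeriv e x (EuclideanSpace.single i 1) := by
  simp [coordBasis]
  rfl

theorem mfderiv_coordVec [IsManifold (𝓡 d) ∞ M] (he : IsCoord e) {x : Coord d} (hx : x ∈ e.target)
    {F : Type*} [NormedAddCommGroup F] [NormedSpace ℝ F] {f : M → F}
    (hf : MDifferentiableAt (𝓡 d) 𝓘(ℝ, F) f (e.symm x)) (i : Fin d) :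
    (mfderiv (𝓡 d) 𝓘(ℝ, F) f (e.symm x) (coordVec e i x) : F) = pd i (fun y => f (e.symm y)) x := by
  have h1 := mfderiv_comp x hf (he.mdifferentiable.mdifferentiableAt_symm hx)
  rw [mfderiv_eq_fderiv] at h1
  have h2 := congrArg (fun T : Coord d →L[ℝ] F => T (EuclideanSpace.single i 1)) h1
  exact h2.symm

/-- A linear map on a tangent space vanishes once it vanishes on the coordinate vectors. -/
theorem linearMap_eq_zero_of_coordVec [IsManifold (𝓡 d) ∞ M] (he : IsCoord e) {x : Coord d}
    (hx : x ∈ e.target) {F : Type*} [AddCommGroup F] [Module ℝ F]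
    {f : TangentSpace (𝓡 d) (e.symm x) →ₗ[ℝ] F} (h : ∀ i, f (coordVec e i x) = 0) : f = 0 :=
  Module.Basis.ext (M := Coord d) (coordBasis he hx) fun i => by
    rw [coordBasis_apply]; exact h i

theorem contDiffOn_transition [IsManifold (𝓡 d) ∞ M] (he : IsCoord e) (he' : IsCoord e') :
    ContDiffOn ℝ ∞ (fun y => e (e'.symm y)) (e'.symm.trans e).source := by
  rw [← contMDiffOn_iff_contDiffOn]
  have h := contMDiffOn_of_mem_maximalAtlas he
  have h' := contMDiffOn_symm_of_mem_maximalAtlas he'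
  refine h.comp (h'.mono fun y hy => ?_) fun y hy => ?_
  · simp at hy; exact hy.1
  · simp at hy; exact hy.2

/-- The Jacobian matrix `∂φ^a/∂x^i` of a map between coordinate domains. -/
def jacobian (φ : Coord d → Coord d) (x : Coord d) : Matrix (Fin d) (Fin d) ℝ :=
  Matrix.of fun a i => pd i (fun y => φ y a) x

theorem pd_coord {φ : Coord d → Coord d} {x : Coord d} (hφ : DifferentiableAt ℝ φ x)
    (i a : Fin d) : fderiv ℝ φ x (EuclideanSpace.single i 1) a = jacobian φ x a i := by
  have h : HasFDerivAt (fun y => φ y a)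
      ((EuclideanSpace.proj a : Coord d →L[ℝ] ℝ) ∘L fderiv ℝ φ x) x :=
    (EuclideanSpace.proj a : Coord d →L[ℝ] ℝ).hasFDerivAt.comp x hφ.hasFDerivAt
  simp [jacobian, pd, h.fderiv]

/-- The metric at `p`, read as a bilinear form on `ℝ^d` through the identification of every
tangent space with the model space. -/
def Metric.form {ε : Fin d → ℤˣ} (g : Metric d M ε) (p : M) : Coord d →ₗ[ℝ] Coord d →ₗ[ℝ] ℝ :=
  g.val p

theorem Metric.comp_apply {ε : Fin d → ℤˣ} (g : Metric d M ε) (x : Coord d) (i j : Fin d) :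
    g.comp e x i j = g.form (e.symm x) (symmDeriv e x (EuclideanSpace.single i 1))
      (symmDeriv e x (EuclideanSpace.single j 1)) := rfl

theorem symmDeriv_change [IsManifold (𝓡 d) ∞ M] (he : IsCoord e) (he' : IsCoord e') {x : Coord d}
    (hx : x ∈ e'.target) (hxe : e'.symm x ∈ e.source) (i : Fin d) :
    symmDeriv e' x (EuclideanSpace.single i 1) = ∑ a, jacobian (fun y => e (e'.symm y)) x a i •
      symmDeriv e (e (e'.symm x)) (EuclideanSpace.single a 1) := by
  have hxs : x ∈ (e'.symm.trans e).source := by simp [hx, hxe]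
  set φ : Coord d → Coord d := fun y => e (e'.symm y) with hφ
  have hd : DifferentiableAt ℝ φ x :=
    ((contDiffOn_transition he he').contDiffAt
      ((e'.symm.trans e).open_source.mem_nhds hxs)).differentiableAt (by simp)
  have hev : e'.symm =ᶠ[𝓝 x] e.symm ∘ φ := by
    filter_upwards [(e'.symm.trans e).open_source.mem_nhds hxs] with y hy
    simp at hy
    simp [hφ, e.left_inv hy.2]
  have h1 := mfderiv_comp (I := 𝓡 d) (I' := 𝓡 d) (I'' := 𝓡 d) x (g := e.symm) (f := φ)
    (he.mdifferentiable.mdifferentiableAt_symm (e.map_source hxe))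
    hd.mdifferentiableAt
  rw [← hev.mfderiv_eq, mfderiv_eq_fderiv] at h1
  have h2 : symmDeriv e' x = symmDeriv e (φ x) ∘L fderiv ℝ φ x := h1
  have hv : fderiv ℝ φ x (EuclideanSpace.single i 1) =
      ∑ a, jacobian φ x a i • EuclideanSpace.single a (1 : ℝ) := by
    have := (EuclideanSpace.basisFun (Fin d) ℝ).sum_repr (fderiv ℝ φ x (EuclideanSpace.single i 1))
    simpa [pd_coord hd] using this.symm
  rw [h2, ContinuousLinearMap.comp_apply, hv, map_sum]
  simp only [map_smul, hφ]

/-- The transformation law of the components of the metric. -/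
theorem Metric.comp_change [IsManifold (𝓡 d) ∞ M] {ε : Fin d → ℤˣ} (g : Metric d M ε)
    (he : IsCoord e) (he' : IsCoord e') {x : Coord d}
    (hx : x ∈ e'.target) (hxe : e'.symm x ∈ e.source) :
    g.comp e' x = (jacobian (fun y => e (e'.symm y)) x).transpose * g.comp e (e (e'.symm x)) *
      jacobian (fun y => e (e'.symm y)) x := by
  ext i j
  simp only [Matrix.mul_apply, Matrix.transpose_apply]
  rw [g.comp_apply, symmDeriv_change he he' hx hxe, symmDeriv_change he he' hx hxe, map_sum]
  simp only [LinearMap.sum_apply, map_sum, map_smul, LinearMap.smul_apply, g.comp_apply,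
    e.left_inv hxe, smul_eq_mul]
  exact Finset.sum_congr rfl fun b _ => mul_comm _ _

theorem isInvertible_fderiv_of_jacobian {φ : Coord d → Coord d} {x : Coord d}
    (hφ : DifferentiableAt ℝ φ x) (h : IsUnit (jacobian φ x).det) :
    (fderiv ℝ φ x).IsInvertible := by
  have hker : ∀ v, fderiv ℝ φ x v = 0 → v = 0 := by
    intro v hv
    have h0 : (jacobian φ x).mulVec v = 0 := by
      ext a
      have := congrArg (fun w : Coord d => w a) hv
      rw [fderiv_eq_sum_pd] at this
      simp only [pd, WithLp.ofLp_sum, WithLp.ofLp_smul, Finset.sum_apply, Pi.smul_apply,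
        pd_coord hφ] at this
      simpa [Matrix.mulVec, dotProduct, mul_comm] using this
    have := Matrix.mulVec_injective_of_isUnit ((Matrix.isUnit_iff_isUnit_det _).2 h)
      (h0.trans (Matrix.mulVec_zero _).symm)
    ext a
    exact congrFun this a
  have hinj : Function.Injective (fderiv ℝ φ x : Coord d →ₗ[ℝ] Coord d) :=
    (injective_iff_map_eq_zero _).2 hker
  exact ⟨(LinearEquiv.ofInjectiveEndo _ hinj).toContinuousLinearEquiv, by ext1; rfl⟩

/-- By the inverse function theorem, smooth functions with invertible Jacobian matrix are
coordinates. -/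
theorem exists_isCoord_comp [IsManifold (𝓡 d) ∞ M] (he : IsCoord e) {p : M} (hp : p ∈ e.source)
    {φ : Coord d → Coord d} {r : ℝ} (hr : 0 < r)
    (hφ : ContDiffOn ℝ ∞ φ (Metric.ball (e p) r))
    (hinv : ∀ x ∈ Metric.ball (e p) r, IsUnit (jacobian φ x).det) :
    ∃ e₁ : OpenPartialHomeomorph M (Coord d), IsCoord e₁ ∧ p ∈ e₁.source ∧
      ∀ q ∈ e₁.source, q ∈ e.source ∧ e q ∈ Metric.ball (e p) r ∧ e₁ q = φ (e q) := by
  have hca : ∀ x ∈ Metric.ball (e p) r, ContDiffAt ℝ ∞ φ x := fun x hx =>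
    hφ.contDiffAt (Metric.isOpen_ball.mem_nhds hx)
  have hp0 : e p ∈ Metric.ball (e p) r := Metric.mem_ball_self hr
  have hinv' : ∀ x ∈ Metric.ball (e p) r, ∃ f' : Coord d ≃L[ℝ] Coord d,
      HasFDerivAt φ (f' : Coord d →L[ℝ] Coord d) x := by
    intro x hx
    have hd := (hca x hx).differentiableAt (by simp)
    obtain ⟨f', hf'⟩ := isInvertible_fderiv_of_jacobian hd (hinv x hx)
    exact ⟨f', hf' ▸ hd.hasFDerivAt⟩
  obtain ⟨f', hf'⟩ := hinv' _ hp0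
  set h := ((hca _ hp0).toOpenPartialHomeomorph φ hf' (by simp)).restrOpen _
    (Metric.isOpen_ball (x := e p) (ε := r)) with hh
  have hcoe : ∀ x, h x = φ x := fun x => rfl
  have hsrc : ∀ x ∈ h.source, x ∈ Metric.ball (e p) r := fun x hx => hx.2
  have hps : e p ∈ h.source :=
    ⟨(hca _ hp0).mem_toOpenPartialHomeomorph_source hf' (by simp), hp0⟩
  have hsymm : ContDiffOn ℝ ∞ h.symm h.target := fun y hy => by
    have hx := hsrc _ (h.map_target hy)
    obtain ⟨f₁, hf₁⟩ := hinv' _ hx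
    exact (h.contDiffAt_symm hy hf₁ (hca _ hx)).contDiffWithinAt
  refine ⟨e.trans h, ?_, ?_, ?_⟩
  · refine OpenPartialHomeomorph.mem_maximalAtlas_of_contMDiffOn _ ?_ ?_
    · have h1 : ContMDiffOn (𝓡 d) (𝓡 d) ∞ h h.source :=
        contMDiffOn_iff_contDiffOn.2 (hφ.mono hsrc)
      refine h1.comp ((contMDiffOn_of_mem_maximalAtlas he).mono fun q hq => ?_) fun q hq => ?_
      · simp at hq; exact hq.1
      · simp at hq; exact hq.2
    · have h1 : ContMDiffOn (𝓡 d) (𝓡 d) ∞ h.symm h.target := contMDiffOn_iff_contDiffOn.2 hsymm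
      refine (contMDiffOn_symm_of_mem_maximalAtlas he).comp (h1.mono fun q hq => ?_)
        fun q hq => ?_
      · rw [OpenPartialHomeomorph.trans_target] at hq; exact hq.1
      · rw [OpenPartialHomeomorph.trans_target] at hq; exact hq.2
  · rw [OpenPartialHomeomorph.trans_source]; exact ⟨hp, hps⟩
  · intro q hq
    rw [OpenPartialHomeomorph.trans_source] at hq
    exact ⟨hq.1, hsrc _ hq.2, rfl⟩

end Charts

/-! ### Curvature and constant components of a metric -/

section MatrixSmooth

variable {d : ℕ} {ι : Type*} [Fintype ι]

theorem contDiffOn_det [DecidableEq ι] {F : Coord d → Matrix ι ι ℝ} {W : Set (Coord d)}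
    (hF : ∀ a b, ContDiffOn ℝ ∞ (fun x => F x a b) W) : ContDiffOn ℝ ∞ (fun x => (F x).det) W := by
  simp only [Matrix.det_apply']
  exact ContDiffOn.sum fun σ _ => contDiffOn_const.mul (contDiffOn_prod fun i _ => hF _ _)

theorem contDiffOn_inv_apply [DecidableEq ι] {F : Coord d → Matrix ι ι ℝ} {W : Set (Coord d)}
    (hF : ∀ a b, ContDiffOn ℝ ∞ (fun x => F x a b) W) (hdet : ∀ x ∈ W, IsUnit (F x).det) (a b : ι) :
    ContDiffOn ℝ ∞ (fun x => (F x)⁻¹ a b) W := by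
  simp only [Matrix.inv_def, Ring.inverse_eq_inv', Matrix.smul_apply, smul_eq_mul,
    Matrix.adjugate_apply]
  refine ((contDiffOn_det hF).inv fun x hx => (hdet x hx).ne_zero).mul (contDiffOn_det ?_)
  intro k l
  by_cases hk : k = b
  · subst hk
    simpa only [Matrix.updateRow_self] using contDiffOn_const
  · simpa only [Matrix.updateRow_ne hk] using hF k l

theorem contDiffOn_mul_apply {κ μ : Type*} {F : Coord d → Matrix κ ι ℝ} {G : Coord d → Matrix ι μ ℝ}
    {W : Set (Coord d)} (hF : ∀ a b, ContDiffOn ℝ ∞ (fun x => F x a b) W)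
    (hG : ∀ a b, ContDiffOn ℝ ∞ (fun x => G x a b) W) (a : κ) (b : μ) :
    ContDiffOn ℝ ∞ (fun x => (F x * G x) a b) W := by
  simp only [Matrix.mul_apply]
  exact ContDiffOn.sum fun k _ => (hF a k).mul (hG k b)

theorem mpd_inv [DecidableEq ι] {F : Coord d → Matrix ι ι ℝ} {x : Coord d}
    (hF : ∀ a b, DifferentiableAt ℝ (fun y => F y a b) x)
    (hF' : ∀ a b, DifferentiableAt ℝ (fun y => (F y)⁻¹ a b) x)
    (hdet : ∀ᶠ y in 𝓝 x, IsUnit (F y).det) (i : Fin d) :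
    mpd i (fun y => (F y)⁻¹) x = -((F x)⁻¹ * mpd i F x * (F x)⁻¹) := by
  have h1 : mpd i (fun y => F y * (F y)⁻¹) x = 0 := by
    rw [mpd_congr (G := fun _ => 1) (hdet.mono fun y hy => Matrix.mul_nonsing_inv _ hy), mpd_const]
  rw [mpd_mul hF hF'] at h1
  have h2 := congrArg (fun A => (F x)⁻¹ * A) h1
  simp only [Matrix.mul_add, Matrix.mul_zero, ← Matrix.mul_assoc,
    Matrix.nonsing_inv_mul _ hdet.self_of_nhds, Matrix.one_mul] at h2
  rw [eq_neg_iff_add_eq_zero, add_comm]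
  exact h2

end MatrixSmooth

theorem eta_mul_eta {d : ℕ} (ε : Fin d → ℤˣ) : eta ε * eta ε = 1 := by
  rw [eta, Matrix.diagonal_mul_diagonal, ← Matrix.diagonal_one]
  congr 1
  ext i
  rcases Int.units_eq_one_or (ε i) with h | h <;> simp [h]

theorem transpose_mul_eta_mul_apply {d : ℕ} (ε : Fin d → ℤˣ) (A B : Matrix (Fin d) (Fin d) ℝ)
    (i j : Fin d) :
    (A.transpose * (eta ε * B)) i j = ∑ m, A m i * (((ε m : ℤ) : ℝ) * B m j) := by
  rw [Matrix.mul_apply]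
  simp only [Matrix.transpose_apply, eta, Matrix.diagonal_mul]

section MetricComponents

variable {d : ℕ} {M : Type*} [TopologicalSpace M] [ChartedSpace (Coord d) M]
  {ε : Fin d → ℤˣ} (g : Metric d M ε) {e e' : OpenPartialHomeomorph M (Coord d)}

theorem Metric.comp_comm (e : OpenPartialHomeomorph M (Coord d)) (x : Coord d) (i j : Fin d) :
    g.comp e x i j = g.comp e x j i := g.symm _ _ _

/-- Sylvester form of the component matrix at a single point. -/
theorem Metric.exists_comp_eq [IsManifold (𝓡 d) ∞ M] (he : IsCoord e) {x : Coord d}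
    (hx : x ∈ e.target) : ∃ P : Matrix (Fin d) (Fin d) ℝ, IsUnit P.det ∧
      g.comp e x = P.transpose * eta ε * P := by
  obtain ⟨b, hb⟩ := g.signature (e.symm x)
  let b' : Module.Basis (Fin d) ℝ (Coord d) := b
  refine ⟨b'.toMatrix (coordBasis he hx), ?_, ?_⟩
  · exact Matrix.isUnit_det_of_right_inverse
      (Module.Basis.toMatrix_mul_toMatrix_flip b' (coordBasis he hx))
  · have h1 : eta ε = LinearMap.BilinForm.toMatrix b' (g.form (e.symm x)) := by
      ext i j
      rw [LinearMap.BilinForm.toMatrix_apply]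
      refine Eq.trans ?_ (hb i j).symm
      simp [eta, Matrix.diagonal_apply]
    rw [h1, LinearMap.BilinForm.toMatrix_mul_basis_toMatrix]
    ext i j
    rw [LinearMap.BilinForm.toMatrix_apply, coordBasis_apply, coordBasis_apply, g.comp_apply]

theorem Metric.isUnit_det_comp [IsManifold (𝓡 d) ∞ M] (he : IsCoord e) {x : Coord d}
    (hx : x ∈ e.target) : IsUnit (g.comp e x).det := by
  obtain ⟨P, hP, h⟩ := g.exists_comp_eq he hx
  have hη : IsUnit (eta ε).det := Matrix.isUnit_det_of_right_inverse (eta_mul_eta ε)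
  rw [h, Matrix.det_mul, Matrix.det_mul, Matrix.det_transpose]
  exact (hP.mul hη).mul hP

/-- The matrix `(C_i)_{lj} = (∂_i g_jl + ∂_j g_il - ∂_l g_ij) / 2` of Christoffel symbols of the
first kind. -/
def Metric.firstKind (e : OpenPartialHomeomorph M (Coord d)) (i : Fin d) (x : Coord d) :
    Matrix (Fin d) (Fin d) ℝ :=
  Matrix.of fun l j => (1 / 2) * (pd i (fun y => g.comp e y j l) x
    + pd j (fun y => g.comp e y i l) x - pd l (fun y => g.comp e y i j) x)

/-- The connection matrix `(Γ_i)^k_j = Γ^k_ij`. -/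
def Metric.connMatrix (e : OpenPartialHomeomorph M (Coord d)) (i : Fin d) (x : Coord d) :
    Matrix (Fin d) (Fin d) ℝ :=
  Matrix.of fun k j => g.christoffel e k i j x

theorem Metric.connMatrix_eq (e : OpenPartialHomeomorph M (Coord d)) (i : Fin d) (x : Coord d) :
    g.connMatrix e i x = (g.comp e x)⁻¹ * g.firstKind e i x := by
  ext k j
  simp only [connMatrix, christoffel, Matrix.of_apply, Matrix.mul_apply, firstKind, Finset.mul_sum]
  exact Finset.sum_congr rfl fun l _ => by ring

theorem Metric.mpd_comp (e : OpenPartialHomeomorph M (Coord d)) (i : Fin d) (x : Coord d) :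
    mpd i (g.comp e) x = g.firstKind e i x + (g.firstKind e i x).transpose := by
  ext l j
  simp only [mpd_apply, firstKind, Matrix.add_apply, Matrix.transpose_apply, Matrix.of_apply,
    g.comp_comm e _ j l]
  ring

theorem Metric.christoffel_comm (e : OpenPartialHomeomorph M (Coord d)) (k i j : Fin d)
    (x : Coord d) : g.christoffel e k i j x = g.christoffel e k j i x := by
  simp only [christoffel, g.comp_comm e _ j i]
  congr 1
  exact Finset.sum_congr rfl fun l _ => by ring

theorem Metric.contDiffOn_comp (he : IsCoord e) (i j : Fin d) :
    ContDiffOn ℝ ∞ (fun x => g.comp e x i j) e.target := g.smooth e he i j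

theorem Metric.contDiffOn_connMatrix [IsManifold (𝓡 d) ∞ M] (he : IsCoord e) (i k j : Fin d) :
    ContDiffOn ℝ ∞ (fun x => g.connMatrix e i x k j) e.target := by
  simp only [g.connMatrix_eq]
  refine contDiffOn_mul_apply
    (contDiffOn_inv_apply (g.contDiffOn_comp he) fun x hx => g.isUnit_det_comp he hx) ?_ k j
  intro l j
  have h := fun a b c => contDiffOn_pd e.open_target (g.contDiffOn_comp he a b) c
  exact contDiffOn_const.mul (((h _ _ _).add (h _ _ _)).sub (h _ _ _))

theorem Metric.riemann_eq (e : OpenPartialHomeomorph M (Coord d)) (l k i j : Fin d) (x : Coord d) :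
    g.riemann e l k i j x = (mpd i (g.connMatrix e j) x - mpd j (g.connMatrix e i) x
      + g.connMatrix e i x * g.connMatrix e j x - g.connMatrix e j x * g.connMatrix e i x) l k := by
  simp only [riemann, Matrix.sub_apply, Matrix.add_apply, mpd_apply, Matrix.mul_apply,
    Finset.sum_sub_distrib, connMatrix, Matrix.of_apply]
  ring

/-- The matrices of the first-order system `∂_i φ = E_i`, `∂_i E_k = E_m Γ^m_ik` for a function
`φ` with parallel differential `E`. -/
def Metric.prolongation (e : OpenPartialHomeomorph M (Coord d)) (i : Fin d) (x : Coord d) :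
    Matrix (Unit ⊕ Fin d) (Unit ⊕ Fin d) ℝ :=
  Matrix.fromBlocks 0 0 (Matrix.of fun m _ => if m = i then 1 else 0) (g.connMatrix e i x)

theorem Metric.prolongation_curvature {x : Coord d} (h : ∀ l k i j, g.riemann e l k i j x = 0)
    (i j : Fin d) :
    mpd i (g.prolongation e j) x - mpd j (g.prolongation e i) x
      + g.prolongation e i x * g.prolongation e j x
      - g.prolongation e j x * g.prolongation e i x = 0 := by
  have hm : ∀ i j, mpd i (g.prolongation e j) x =
      Matrix.fromBlocks 0 0 0 (mpd i (g.connMatrix e j) x) := by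
    intro i j
    ext (a | a) (b | b) <;> simp [mpd_apply, prolongation, pd]
  rw [hm, hm]
  simp only [prolongation, Matrix.fromBlocks_multiply]
  ext (a | a) (b | b)
  · simp
  · simp
  · simp [Matrix.mul_apply, connMatrix, g.christoffel_comm e a i j]
  · simpa [g.riemann_eq] using h a b i j

/-- Where the curvature vanishes on a coordinate domain, there are coordinates in which the metric
is constant and diagonal. -/
theorem Metric.exists_comp_eq_eta [IsManifold (𝓡 d) ∞ M] (he : IsCoord e) {p : M}
    (hp : p ∈ e.source) (h : ∀ x ∈ e.target, ∀ l k i j, g.riemann e l k i j x = 0) :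
    ∃ e₁ : OpenPartialHomeomorph M (Coord d), IsCoord e₁ ∧ p ∈ e₁.source ∧
      ∀ x ∈ e₁.target, g.comp e₁ x = eta ε := by
  have hsm : ∀ i a b, ContDiffOn ℝ ∞ (fun x => g.prolongation e i x a b) e.target := by
    rintro i (a | a) (b | b)
    · exact contDiffOn_const
    · exact contDiffOn_const
    · exact contDiffOn_const
    · exact g.contDiffOn_connMatrix he i a b
  obtain ⟨r, hr, hball, hsol⟩ := exists_mpd_eq_mul (κ := Fin d) e.open_target hsm
    (fun x hx => g.prolongation_curvature (h x hx)) (e.map_source hp)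
  obtain ⟨P, hP, hGP⟩ := g.exists_comp_eq he (e.map_source hp)
  -- The rows of `P` are the coframe dual to an orthonormal basis at `p`, and become the initial
  -- values of `dφ^a`; the value `φ^a (p) = 0` is arbitrary.
  obtain ⟨E, hE0, hEs, hE⟩ := hsol (Matrix.fromCols 0 P)
  have hp0 : e p ∈ Metric.ball (e p) r := Metric.mem_ball_self hr
  set φ : Coord d → Coord d := fun y => WithLp.toLp 2 fun a => E y a (Sum.inl ()) with hφ
  set J : Coord d → Matrix (Fin d) (Fin d) ℝ := fun y => (E y).toCols₂ with hJ
  have hφs : ContDiffOn ℝ ∞ φ (Metric.ball (e p) r) :=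
    contDiffOn_euclidean.2 fun a => hEs a _
  have hJs : ∀ a b, ContDiffOn ℝ ∞ (fun y => J y a b) (Metric.ball (e p) r) := fun a b => hEs a _
  have hJac : ∀ x ∈ Metric.ball (e p) r, jacobian φ x = J x := by
    intro x hx
    ext a i
    have := congrFun (congrFun (hE x hx i) a) (Sum.inl ())
    rw [mpd_apply, Matrix.mul_apply, Fintype.sum_sum_type] at this
    simpa [prolongation, jacobian, hφ, hJ] using this
  have hJd : ∀ x ∈ Metric.ball (e p) r, ∀ i, mpd i J x = J x * g.connMatrix e i x := by
    intro x hx i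
    ext a k
    have := congrFun (congrFun (hE x hx i) a) (Sum.inr k)
    rw [mpd_apply, Matrix.mul_apply, Fintype.sum_sum_type] at this
    simpa [prolongation, hJ, mpd_apply, Matrix.mul_apply] using this
  have hGd : ∀ i j, ContDiffOn ℝ ∞ (fun x => g.comp e x i j) (Metric.ball (e p) r) := fun i j =>
    (g.contDiffOn_comp he i j).mono hball
  have hGu : ∀ x ∈ Metric.ball (e p) r, IsUnit (g.comp e x).det := fun x hx =>
    g.isUnit_det_comp he (hball hx)
  have hGi := contDiffOn_inv_apply hGd hGu
  have hdiff : ∀ {f : Coord d → ℝ}, ContDiffOn ℝ ∞ f (Metric.ball (e p) r) →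
      ∀ x ∈ Metric.ball (e p) r, DifferentiableAt ℝ f x := fun hf x hx =>
    (hf.contDiffAt (Metric.isOpen_ball.mem_nhds hx)).differentiableAt (by simp)
  -- The pairings `g⁻¹(dφ^a, dφ^b)` of parallel covectors are constant.
  have hK : ∀ x ∈ Metric.ball (e p) r, J x * (g.comp e x)⁻¹ * (J x).transpose = eta ε := by
    intro x hx
    have hGT : ∀ y, (g.comp e y)⁻¹.transpose = (g.comp e y)⁻¹ := by
      intro y
      rw [Matrix.transpose_nonsing_inv]
      congr 1
      ext i j
      exact g.comp_comm e y j i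
    have hJG := contDiffOn_mul_apply hJs hGi
    have h0 : J (e p) * (g.comp e (e p))⁻¹ * (J (e p)).transpose = eta ε := by
      have : J (e p) = P := by ext a b; simp [hJ, hE0]
      rw [this, hGP, Matrix.mul_inv_rev, Matrix.mul_inv_rev,
        Matrix.inv_eq_right_inv (eta_mul_eta ε), ← Matrix.mul_assoc, Matrix.mul_nonsing_inv _ hP,
        Matrix.one_mul, Matrix.mul_assoc, Matrix.nonsing_inv_mul _ (by rwa [Matrix.det_transpose]),
        Matrix.mul_one]
    rw [← h0]
    refine eq_of_mpd_eq_zero (F := fun y => J y * (g.comp e y)⁻¹ * (J y).transpose)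
      (fun y hy a b => hdiff (contDiffOn_mul_apply hJG (fun a b => hJs b a) a b) y hy)
      (fun y hy i => ?_) hx
    rw [mpd_mul (G := fun y => (J y).transpose) (fun a b => hdiff (hJG a b) y hy)
        (fun a b => hdiff (hJs b a) y hy),
      mpd_mul (fun a b => hdiff (hJs a b) y hy) (fun a b => hdiff (hGi a b) y hy),
      mpd_inv (fun a b => hdiff (hGd a b) y hy) (fun a b => hdiff (hGi a b) y hy)
        (Filter.eventually_of_mem (Metric.isOpen_ball.mem_nhds hy) hGu),
      mpd_transpose, hJd y hy, g.mpd_comp, g.connMatrix_eq]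
    simp only [Matrix.transpose_mul, hGT, Matrix.mul_add, Matrix.add_mul, Matrix.mul_neg,
      Matrix.neg_mul, Matrix.mul_assoc]
    abel
  have hkey : ∀ x ∈ Metric.ball (e p) r, IsUnit (J x).det ∧
      g.comp e x = (J x).transpose * eta ε * J x := by
    intro x hx
    have h1 : (eta ε * J x * (g.comp e x)⁻¹) * (J x).transpose = 1 := by
      rw [← eta_mul_eta ε, ← hK x hx]
      simp only [Matrix.mul_assoc]
    have h2 := mul_eq_one_comm.1 h1
    refine ⟨?_, ?_⟩
    · have := Matrix.isUnit_det_of_left_inverse h1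
      rwa [Matrix.det_transpose] at this
    · have h3 : ((J x).transpose * eta ε * J x) * (g.comp e x)⁻¹ = 1 := by
        rw [← h2]; simp only [Matrix.mul_assoc]
      calc g.comp e x = ((J x).transpose * eta ε * J x) * (g.comp e x)⁻¹ * g.comp e x := by
            rw [h3, Matrix.one_mul]
        _ = _ := by rw [Matrix.mul_assoc, Matrix.nonsing_inv_mul _ (hGu x hx), Matrix.mul_one]
  obtain ⟨e₁, he₁, hpe₁, hcoe⟩ := exists_isCoord_comp he hp hr hφs fun x hx => by
    rw [hJac x hx]; exact (hkey x hx).1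
  refine ⟨e₁, he₁, hpe₁, fun x₁ hx₁ => ?_⟩
  have hq := e₁.map_target hx₁
  obtain ⟨hqe, hqb, hqv⟩ := hcoe _ hq
  set x := e (e₁.symm x₁) with hx
  have hxq : e.symm x = e₁.symm x₁ := e.left_inv hqe
  have hxt : x ∈ e.target := e.map_source hqe
  have hch := g.comp_change he₁ he hxt (by rw [hxq]; exact hq)
  have hjac : jacobian (fun y => e₁ (e.symm y)) x = J x := by
    rw [← hJac x hqb]
    have hev : (fun y => e₁ (e.symm y)) =ᶠ[𝓝 x] φ := by
      have hx' : x ∈ (e.symm.trans e₁).source := by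
        rw [OpenPartialHomeomorph.trans_source]; exact ⟨hxt, by simpa [hxq] using hq⟩
      filter_upwards [(e.symm.trans e₁).open_source.mem_nhds hx'] with y hy
      rw [OpenPartialHomeomorph.trans_source] at hy
      rw [(hcoe _ hy.2).2.2, e.right_inv hy.1]
    ext a i
    exact pd_congr (hev.mono fun y hy => by simp only [hy]) i
  rw [hjac, hxq, e₁.right_inv hx₁, (hkey x hqb).2] at hch
  have hu := (hkey x hqb).1
  have hu' : IsUnit (J x).transpose.det := by rwa [Matrix.det_transpose]
  exact (((Matrix.isUnit_iff_isUnit_det _).2 hu').mul_right_inj.1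
    (((Matrix.isUnit_iff_isUnit_det _).2 hu).mul_left_inj.1 hch)).symm

theorem Metric.firstKind_of_comp_eq {J : Coord d → Matrix (Fin d) (Fin d) ℝ} {x : Coord d}
    (hJ : ∀ a b, DifferentiableAt ℝ (fun y => J y a b) x)
    (hsymm : ∀ i j a, mpd i J x a j = mpd j J x a i)
    (h : ∀ᶠ y in 𝓝 x, g.comp e y = (J y).transpose * (eta ε * J y)) (i : Fin d) :
    g.firstKind e i x = (J x).transpose * (eta ε * mpd i J x) := by
  have hd : ∀ k, mpd k (g.comp e) x = (mpd k J x).transpose * (eta ε * J x)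
      + (J x).transpose * (eta ε * mpd k J x) := by
    intro k
    rw [mpd_congr h, mpd_mul (F := fun y => (J y).transpose) (G := fun y => eta ε * J y)
      (fun a b => hJ b a) ?_, mpd_transpose, mpd_const_mul _ hJ]
    intro a b
    simp only [eta, Matrix.diagonal_mul]
    exact (hJ a b).const_mul _
  have he : ∀ k a b, pd k (fun y => g.comp e y a b) x =
      ∑ m, (ε m : ℤ) * (mpd k J x m a * J x m b + J x m a * mpd k J x m b) := by
    intro k a b
    rw [← mpd_apply, hd k]
    simp only [Matrix.add_apply, transpose_mul_eta_mul_apply, ← Finset.sum_add_distrib]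
    exact Finset.sum_congr rfl fun m _ => by ring
  ext l j
  simp only [firstKind, Matrix.of_apply, he, transpose_mul_eta_mul_apply]
  rw [← Finset.sum_add_distrib, ← Finset.sum_sub_distrib, Finset.mul_sum]
  refine Finset.sum_congr rfl fun m _ => ?_
  rw [hsymm j i m, hsymm l i m, hsymm l j m]
  ring

/-- The curvature vanishes at every point around which there are coordinates in which the metric
is constant and diagonal: the Jacobian matrix `J` of these coordinates satisfies `∂_i J = J Γ_i`. -/
theorem Metric.riemann_eq_zero_of_comp_eq_eta [IsManifold (𝓡 d) ∞ M] (he : IsCoord e)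
    (he' : IsCoord e') (h : ∀ x ∈ e.target, g.comp e x = eta ε) {x : Coord d} (hx : x ∈ e'.target)
    (hxe : e'.symm x ∈ e.source) (l k i j : Fin d) : g.riemann e' l k i j x = 0 := by
  set φ : Coord d → Coord d := fun y => e (e'.symm y) with hφ
  have hxs : x ∈ (e'.symm.trans e).source := by simp [hx, hxe]
  have hW := (e'.symm.trans e).open_source
  have hφs : ContDiffOn ℝ ∞ φ (e'.symm.trans e).source := contDiffOn_transition he he'
  have hφa : ∀ a, ContDiffOn ℝ ∞ (fun y => φ y a) (e'.symm.trans e).source := fun a =>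
    contDiffOn_euclidean.1 hφs a
  have hJs : ∀ a b, ContDiffOn ℝ ∞ (fun y => jacobian φ y a b) (e'.symm.trans e).source :=
    fun a b => contDiffOn_pd hW (hφa a) b
  have hJd : ∀ y ∈ (e'.symm.trans e).source, ∀ a b,
      DifferentiableAt ℝ (fun y => jacobian φ y a b) y := fun y hy a b =>
    ((hJs a b).contDiffAt (hW.mem_nhds hy)).differentiableAt (by simp)
  have hG : ∀ y ∈ (e'.symm.trans e).source,
      g.comp e' y = (jacobian φ y).transpose * (eta ε * jacobian φ y) := by
    intro y hy
    rw [OpenPartialHomeomorph.trans_source] at hy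
    rw [g.comp_change he he' hy.1 hy.2, h _ (e.map_source hy.2), Matrix.mul_assoc]
  have hconn : ∀ y ∈ (e'.symm.trans e).source, ∀ i,
      mpd i (jacobian φ) y = jacobian φ y * g.connMatrix e' i y := by
    intro y hy i
    have hsymm : ∀ i j a, mpd i (jacobian φ) y a j = mpd j (jacobian φ) y a i := fun i j a =>
      pd_comm (((hφa a).contDiffAt (hW.mem_nhds hy)).of_le ENat.LEInfty.out) i j
    rw [g.connMatrix_eq, g.firstKind_of_comp_eq (hJd y hy) hsymm
      (Filter.eventually_of_mem (hW.mem_nhds hy) hG)]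
    have h1 : ((g.comp e' y)⁻¹ * (jacobian φ y).transpose * eta ε) * jacobian φ y = 1 := by
      rw [OpenPartialHomeomorph.trans_source] at hy
      calc _ = (g.comp e' y)⁻¹ * ((jacobian φ y).transpose * (eta ε * jacobian φ y)) := by
            simp only [Matrix.mul_assoc]
        _ = 1 := by
            rw [← hG y (by rw [OpenPartialHomeomorph.trans_source]; exact hy),
              Matrix.nonsing_inv_mul _ (g.isUnit_det_comp he' hy.1)]
    have h2 := mul_eq_one_comm.1 h1
    calc mpd i (jacobian φ) y = (jacobian φ y *
          ((g.comp e' y)⁻¹ * (jacobian φ y).transpose * eta ε)) * mpd i (jacobian φ) y := by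
          rw [h2, Matrix.one_mul]
      _ = _ := by simp only [Matrix.mul_assoc]
  have hcurv := mul_curvature_eq_zero (M := g.connMatrix e') (E := jacobian φ) (x := x)
    (fun a b => ((hJs a b).contDiffAt (hW.mem_nhds hxs)).of_le ENat.LEInfty.out)
    (fun i a b => ((g.contDiffOn_connMatrix he' i a b).contDiffAt
      (e'.open_target.mem_nhds hx)).differentiableAt (by simp))
    (Filter.eventually_of_mem (hW.mem_nhds hxs) hconn) i j
  have hu : IsUnit (jacobian φ x).det := by
    have := g.isUnit_det_comp he' hx
    rw [hG x hxs, Matrix.det_mul, Matrix.det_mul] at this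
    exact isUnit_of_mul_isUnit_right (isUnit_of_mul_isUnit_right this)
  rw [g.riemann_eq]
  have h3 := congrArg (fun A => (jacobian φ x)⁻¹ * A) hcurv
  simp only [← Matrix.mul_assoc, Matrix.nonsing_inv_mul _ hu, Matrix.mul_zero] at h3
  rw [Matrix.one_mul] at h3
  rw [h3]
  rfl

theorem Metric.christoffel_eq_zero_of_comp_eq_eta (h : ∀ x ∈ e.target, g.comp e x = eta ε)
    {x : Coord d} (hx : x ∈ e.target) (k i j : Fin d) : g.christoffel e k i j x = 0 := by
  have hz : ∀ m a b, pd m (fun y => g.comp e y a b) x = 0 := by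
    intro m a b
    rw [← mpd_apply, mpd_congr (G := fun _ => eta ε)
      (Filter.eventually_of_mem (e.open_target.mem_nhds hx) h), mpd_const]
    rfl
  simp [christoffel, hz]

theorem Metric.riemann_eq_zero_of_christoffel_eq_zero
    (h : ∀ x ∈ e.target, ∀ k i j, g.christoffel e k i j x = 0)
    {x : Coord d} (hx : x ∈ e.target) (l k i j : Fin d) : g.riemann e l k i j x = 0 := by
  have hz : ∀ m a b c, pd m (g.christoffel e a b c) x = 0 := by
    intro m a b c
    rw [pd_congr (f' := fun _ => 0)
      (Filter.eventually_of_mem (e.open_target.mem_nhds hx) fun y hy => h y hy a b c)]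
    simp [pd]
  simp [riemann, hz, h x hx]

theorem Metric.christoffelNeZero_iff_compNeEta [IsManifold (𝓡 d) ∞ M] (p : M) :
    g.ChristoffelNeZero p ↔ g.CompNeEta p := by
  rw [← not_iff_not]
  constructor
  · intro h
    simp only [ChristoffelNeZero, not_forall, not_exists, not_and, not_not] at h
    obtain ⟨e, he, hp, h0⟩ := h
    obtain ⟨e₁, he₁, hp₁, h₁⟩ := g.exists_comp_eq_eta he hp fun x hx l k i j =>
      g.riemann_eq_zero_of_christoffel_eq_zero h0 hx l k i j
    intro hc
    obtain ⟨x, hx, hne⟩ := hc e₁ he₁ hp₁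
    exact hne (h₁ x hx)
  · intro h hc
    simp only [CompNeEta, not_forall, not_exists, not_and, not_not] at h
    obtain ⟨e, he, hp, h0⟩ := h
    obtain ⟨x, hx, k, i, j, hne⟩ := hc e he hp
    exact hne (g.christoffel_eq_zero_of_comp_eq_eta h0 hx k i j)

theorem Metric.isCurved_iff_exists_compNeEta [IsManifold (𝓡 d) ∞ M] :
    g.IsCurved ↔ ∃ p : M, g.CompNeEta p := by
  constructor
  · rintro ⟨e', he', x, hx, l, k, i, j, hne⟩
    refine ⟨e'.symm x, fun e he hxe => ?_⟩
    by_contra! h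
    exact hne (g.riemann_eq_zero_of_comp_eq_eta he he' h hx hxe l k i j)
  · rintro ⟨p, hp⟩
    by_contra h
    simp only [IsCurved, not_exists, not_and, not_not] at h
    have he := IsManifold.chart_mem_maximalAtlas (I := 𝓡 d) (n := ∞) p
    obtain ⟨e₁, he₁, hp₁, h₁⟩ := g.exists_comp_eq_eta he (mem_chart_source _ p) fun x hx => h _ he x hx
    obtain ⟨x, hx, hne⟩ := hp e₁ he₁ hp₁
    exact hne (h₁ x hx)

end MetricComponents

/-! ### Curvature and gauge fields -/

section ComplexMatrices

variable {d n : ℕ}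

theorem pd_star (f : Coord d → ℂ) (x : Coord d) (i : Fin d) :
    pd i (fun y => star (f y)) x = star (pd i f x) := by
  unfold pd
  rw [fderiv_star]
  rfl

theorem pd_apply {f : Coord d → Fin n → ℂ} {x : Coord d} (hf : DifferentiableAt ℝ f x)
    (i : Fin d) (b : Fin n) : pd i f x b = pd i (fun y => f y b) x := by
  unfold pd
  rw [(hasFDerivAt_pi'.1 hf.hasFDerivAt b).fderiv]
  rfl

theorem mpd_conjTranspose (F : Coord d → Matrix (Fin n) (Fin n) ℂ) (x : Coord d) (i : Fin d) :
    mpd i (fun y => (F y).conjTranspose) x = (mpd i F x).conjTranspose := by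
  ext a b
  exact pd_star (fun y => F y b a) x i

theorem hasFDerivAt_det {E : Coord d → Matrix (Fin n) (Fin n) ℂ} {x : Coord d}
    (hE : ∀ a b, DifferentiableAt ℝ (fun y => E y a b) x) :
    HasFDerivAt (fun y => (E y).det) (∑ σ : Equiv.Perm (Fin n), ((Equiv.Perm.sign σ : ℤ) : ℂ) •
      ∑ b, (∏ k ∈ Finset.univ.erase b, E x (σ k) k) • fderiv ℝ (fun y => E y (σ b) b) x) x := by
  simp only [Matrix.det_apply']
  exact HasFDerivAt.fun_sum fun σ _ =>
    (HasFDerivAt.finsetProd fun b _ => (hE (σ b) b).hasFDerivAt).const_mul _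

/-- **Jacobi's formula** for a solution of `∂_i E = E N`. -/
theorem pd_det {E : Coord d → Matrix (Fin n) (Fin n) ℂ} {N : Matrix (Fin n) (Fin n) ℂ}
    {x : Coord d} (hE : ∀ a b, DifferentiableAt ℝ (fun y => E y a b) x) {i : Fin d}
    (h : mpd i E x = E x * N) : pd i (fun y => (E y).det) x = N.trace * (E x).det := by
  have h1 : pd i (fun y => (E y).det) x =
      ∑ b, ((E x).updateCol b fun a => mpd i E x a b).det := by
    simp only [Matrix.det_apply' (Matrix.updateCol _ _ _)]
    unfold pd
    rw [(hasFDerivAt_det hE).fderiv, Finset.sum_comm]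
    simp only [FunLike.coe_sum, Finset.sum_apply, smul_apply, smul_eq_mul, Finset.mul_sum]
    refine Finset.sum_congr rfl fun σ _ => Finset.sum_congr rfl fun b _ => ?_
    rw [← Finset.mul_prod_erase _ _ (Finset.mem_univ b), Matrix.updateCol_self,
      Finset.prod_congr rfl fun k hk => Matrix.updateCol_ne (Finset.ne_of_mem_erase hk), mpd_apply]
    unfold pd
    ring
  rw [h1, Matrix.trace, Finset.sum_mul]
  refine Finset.sum_congr rfl fun b _ => ?_
  have h2 : (fun a => mpd i E x a b) = fun a => ∑ l, N l b • E x a l := by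
    ext a
    rw [h, Matrix.mul_apply]
    exact Finset.sum_congr rfl fun l _ => mul_comm _ _
  rw [h2, Matrix.det_updateCol_sum]
  rfl

end ComplexMatrices

section Gauge

variable {d : ℕ} {M : Type*} [TopologicalSpace M] [ChartedSpace (Coord d) M]
  {K : GaugeGroup} {n : ℕ} (A : GaugeField d M K n) (c : ℝ)
  {e : OpenPartialHomeomorph M (Coord d)}

theorem GaugeField.isHermitian (p : M) (v : TangentSpace (𝓡 d) p) : (A.val p v).IsHermitian := by
  have h := A.mem p v
  cases K
  · exact h
  · exact h.1

theorem GaugeField.contDiffOn_comp (he : IsCoord e) (i : Fin d) (a b : Fin n) :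
    ContDiffOn ℝ ∞ (fun x => A.comp e i x a b) e.target := A.smooth e he i a b

theorem GaugeField.differentiableAt_comp (he : IsCoord e) {x : Coord d} (hx : x ∈ e.target)
    (i : Fin d) (a b : Fin n) : DifferentiableAt ℝ (fun y => A.comp e i y a b) x :=
  ((A.contDiffOn_comp he i a b).contDiffAt (e.open_target.mem_nhds hx)).differentiableAt (by simp)

theorem GaugeField.curvature_eq (e : OpenPartialHomeomorph M (Coord d)) (i j : Fin d)
    (x : Coord d) : A.curvature c e i j x = mpd i (A.comp e j) x - mpd j (A.comp e i) x
      + (Complex.I * (c : ℂ)) • (A.comp e i x * A.comp e j x - A.comp e j x * A.comp e i x) := rfl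

/-- By linearity in `v`, whether `D_v s = 0` for all `v` can be tested on the coordinate
vectors. -/
theorem GaugeField.covDeriv_eq_zero_iff [IsManifold (𝓡 d) ∞ M] (he : IsCoord e) {x : Coord d}
    (hx : x ∈ e.target) {s : M → Fin n → ℂ}
    (hs : MDifferentiableAt (𝓡 d) 𝓘(ℝ, Fin n → ℂ) s (e.symm x)) :
    (∀ v, A.covDeriv c s (e.symm x) v = 0) ↔ ∀ i, pd i (fun y => s (e.symm y)) x
      + (Complex.I * (c : ℂ)) • (A.comp e i x).mulVec (s (e.symm x)) = 0 := by
  have hcoord : ∀ i, A.covDeriv c s (e.symm x) (coordVec e i x) = pd i (fun y => s (e.symm y)) x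
      + (Complex.I * (c : ℂ)) • (A.comp e i x).mulVec (s (e.symm x)) := by
    intro i
    rw [covDeriv, flatDeriv, mfderiv_coordVec he hx hs]
    rfl
  constructor
  · intro h i
    rw [← hcoord, h]
  · intro h v
    let T : TangentSpace (𝓡 d) (e.symm x) →ₗ[ℝ] (Fin n → ℂ) :=
      { toFun := A.covDeriv c s (e.symm x)
        map_add' := fun v w => by
          simp only [covDeriv, flatDeriv, map_add, Matrix.add_mulVec, smul_add]
          exact add_add_add_comm _ _ _ _
        map_smul' := fun t v => by
          simp only [covDeriv, flatDeriv, map_smul, Matrix.smul_mulVec, RingHom.id_apply]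
          refine Eq.trans ?_ (smul_add t (_ : Fin n → ℂ) _).symm
          rw [smul_comm t (Complex.I * (c : ℂ))]
          rfl }
    have hT : T = 0 := linearMap_eq_zero_of_coordVec he hx fun i => by
      rw [← h i, ← hcoord]; rfl
    exact congrArg (fun S => S v) hT

/-- The gauge transform of `A` by `Ω` vanishes at a point iff `∂_i Ω = i c Ω A_i` there: multiply
`Ω A Ω⁻¹ + (i/c) (dΩ) Ω⁻¹ = 0` on the right by `Ω`. -/
theorem GaugeField.transform_eq_zero_iff [IsManifold (𝓡 d) ∞ M] (hc : c ≠ 0) (he : IsCoord e)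
    {x : Coord d} (hx : x ∈ e.target) {Ω : M → Matrix (Fin n) (Fin n) ℂ}
    (hu : IsUnit (Ω (e.symm x)).det)
    (hΩ : ∀ a b, MDifferentiableAt (𝓡 d) 𝓘(ℝ, ℂ) (fun q => Ω q a b) (e.symm x)) :
    (∀ v, A.transform c Ω (e.symm x) v = 0) ↔ ∀ i, mpd i (fun y => Ω (e.symm y)) x =
      Ω (e.symm x) * ((Complex.I * (c : ℂ)) • A.comp e i x) := by
  have hc' : (c : ℂ) ≠ 0 := by exact_mod_cast hc
  set D : TangentSpace (𝓡 d) (e.symm x) → Matrix (Fin n) (Fin n) ℂ := fun v =>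
    Matrix.of fun a b => (mfderiv (𝓡 d) 𝓘(ℝ, ℂ) (fun q => Ω q a b) (e.symm x) v : ℂ) with hD
  have hDc : ∀ i, D (coordVec e i x) = mpd i (fun y => Ω (e.symm y)) x := by
    intro i
    ext a b
    exact mfderiv_coordVec he hx (hΩ a b) i
  have hiff : ∀ v, A.transform c Ω (e.symm x) v = 0 ↔
      D v - Ω (e.symm x) * ((Complex.I * (c : ℂ)) • A.val (e.symm x) v) = 0 := by
    intro v
    have h1 : A.transform c Ω (e.symm x) v = (Complex.I / (c : ℂ)) •
        ((D v - Ω (e.symm x) * ((Complex.I * (c : ℂ)) • A.val (e.symm x) v))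
          * (Ω (e.symm x))⁻¹) := by
      have h2 : Complex.I / (c : ℂ) * (Complex.I * c) = -1 := by
        field_simp
        exact Complex.I_sq
      rw [transform, Matrix.sub_mul, smul_sub, Matrix.mul_smul, Matrix.smul_mul, smul_smul, h2,
        neg_one_smul, sub_neg_eq_add, add_comm]
    have hui := (Matrix.isUnit_iff_isUnit_det _).2 (Matrix.isUnit_nonsing_inv_det _ hu)
    rw [h1, smul_eq_zero_iff_right (div_ne_zero Complex.I_ne_zero hc'), hui.mul_left_eq_zero]
  constructor
  · intro h i
    rw [← hDc, ← sub_eq_zero]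
    exact (hiff _).1 (h _)
  · intro h v
    rw [hiff]
    let T : TangentSpace (𝓡 d) (e.symm x) →ₗ[ℝ] Matrix (Fin n) (Fin n) ℂ :=
      { toFun := fun v => D v - Ω (e.symm x) * ((Complex.I * (c : ℂ)) • A.val (e.symm x) v)
        map_add' := fun v w => by
          have : D (v + w) = D v + D w := by
            ext a b
            exact map_add (mfderiv (𝓡 d) 𝓘(ℝ, ℂ) (fun q => Ω q a b) (e.symm x)) v w
          rw [this, map_add, smul_add, Matrix.mul_add]
          abel
        map_smul' := fun t v => by
          have : D (t • v) = t • D v := by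
            ext a b
            exact map_smul (mfderiv (𝓡 d) 𝓘(ℝ, ℂ) (fun q => Ω q a b) (e.symm x)) t v
          rw [this, map_smul, smul_comm, Matrix.mul_smul, RingHom.id_apply, smul_sub] }
    have hT : T = 0 := linearMap_eq_zero_of_coordVec he hx fun i => by
      rw [← sub_eq_zero.2 (h i), ← hDc]; rfl
    exact congrArg (fun S => S v) hT

theorem GaugeGroup.conjTranspose_mul_self {X : Matrix (Fin n) (Fin n) ℂ} (h : X ∈ K.group n) :
    X.conjTranspose * X = 1 := by
  cases K
  · exact Matrix.mem_unitaryGroup_iff'.1 h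
  · exact Matrix.mem_unitaryGroup_iff'.1 (Matrix.mem_specialUnitaryGroup_iff.1 h).1

/-- The solution of `∂_i E = i c E A_i` with initial value `1` takes values in the gauge group. -/
theorem GaugeField.mem_group_of_mpd_eq {E : Coord d → Matrix (Fin n) (Fin n) ℂ} {x₀ : Coord d} {r : ℝ}
    (hEd : ∀ x ∈ Metric.ball x₀ r, ∀ a b, DifferentiableAt ℝ (fun y => E y a b) x)
    (hE : ∀ x ∈ Metric.ball x₀ r, ∀ i, mpd i E x = E x * ((Complex.I * (c : ℂ)) • A.comp e i x))
    (h0 : E x₀ = 1) {x : Coord d} (hx : x ∈ Metric.ball x₀ r) : E x ∈ K.group n := by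
  have hU : E x * (E x).conjTranspose = 1 := by
    have h1 : E x₀ * (E x₀).conjTranspose = 1 := by simp [h0]
    rw [← h1]
    refine eq_of_mpd_eq_zero (F := fun y => E y * (E y).conjTranspose) (fun y hy a b => ?_)
      (fun y hy i => ?_) hx
    · simp only [Matrix.mul_apply, Matrix.conjTranspose_apply]
      exact DifferentiableAt.fun_sum fun k _ => (hEd y hy a k).mul (hEd y hy b k).star
    · have hA : (A.comp e i y).conjTranspose = A.comp e i y := A.isHermitian _ _
      rw [mpd_mul (G := fun y => (E y).conjTranspose) (hEd y hy)
        (fun a b => (hEd y hy b a).star), mpd_conjTranspose, hE y hy, Matrix.conjTranspose_mul,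
        Matrix.conjTranspose_smul, hA]
      simp [Matrix.mul_assoc]
  have hU' : E x ∈ Matrix.unitaryGroup (Fin n) ℂ := Matrix.mem_unitaryGroup_iff.2 hU
  cases K with
  | U => exact hU'
  | SU =>
    refine Matrix.mem_specialUnitaryGroup_iff.2 ⟨hU', ?_⟩
    have h1 : (E x₀).det = 1 := by simp [h0]
    rw [← h1]
    refine eq_of_pd_eq_zero (f := fun y => (E y).det)
      (fun y hy => (hasFDerivAt_det (hEd y hy)).differentiableAt) (fun y hy i => ?_) hx
    have ht : (A.comp e i y).trace = 0 := (A.mem _ _).2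
    rw [pd_det (hEd y hy) (hE y hy i), Matrix.trace_smul, ht, smul_zero, zero_mul]

/-- Where the curvature vanishes on a coordinate domain, the gauge field can be gauged away
around each of its points. -/
theorem GaugeField.not_neZeroInAllGauges_of_curvature [IsManifold (𝓡 d) ∞ M] (hc : c ≠ 0)
    (he : IsCoord e) {p : M} (hp : p ∈ e.source)
    (h : ∀ x ∈ e.target, ∀ i j, A.curvature c e i j x = 0) : ¬ A.NeZeroInAllGauges c p := by
  obtain ⟨r, hr, hball, hsol⟩ := exists_mpd_eq_mul (κ := Fin n)
    (M := fun i x => (Complex.I * (c : ℂ)) • A.comp e i x) e.open_target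
    (fun i a b => contDiffOn_const.mul (A.contDiffOn_comp he i a b))
    (fun x hx i j => by
      have hF := h x hx i j
      rw [A.curvature_eq] at hF
      rw [mpd_const_smul _ _ _ (A.differentiableAt_comp he hx j),
        mpd_const_smul _ _ _ (A.differentiableAt_comp he hx i)]
      have := congrArg (fun F => (Complex.I * (c : ℂ)) • F) hF
      simp only [smul_add, smul_sub, smul_smul, smul_zero] at this
      simp only [Matrix.smul_mul, Matrix.mul_smul, smul_smul]
      rw [← this]
      abel)
    (e.map_source hp)
  obtain ⟨E, hE0, hEs, hE⟩ := hsol 1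
  have hEd : ∀ x ∈ Metric.ball (e p) r, ∀ a b, DifferentiableAt ℝ (fun y => E y a b) x :=
    fun x hx a b => ((hEs a b).contDiffAt (Metric.isOpen_ball.mem_nhds hx)).differentiableAt
      (by simp)
  have hUo : IsOpen (e.source ∩ e ⁻¹' Metric.ball (e p) r) :=
    e.isOpen_inter_preimage Metric.isOpen_ball
  have hΩs : ∀ a b, ContMDiffOn (𝓡 d) 𝓘(ℝ, ℂ) ∞ (fun q => E (e q) a b)
      (e.source ∩ e ⁻¹' Metric.ball (e p) r) := fun a b =>
    (contMDiffOn_iff_contDiffOn.2 (hEs a b)).comp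
      ((contMDiffOn_of_mem_maximalAtlas he).mono inter_subset_left) fun q hq => hq.2
  intro hne
  obtain ⟨q, hq, v, hv⟩ := hne _ (fun q => E (e q)) hUo ⟨hp, Metric.mem_ball_self hr⟩
    (fun q hq => A.mem_group_of_mpd_eq c hEd hE hE0 hq.2) hΩs
  refine hv ?_
  obtain ⟨x, hx, rfl⟩ : ∃ x ∈ e.target, e.symm x = q := ⟨e q, e.map_source hq.1, e.left_inv hq.1⟩
  have hxb : x ∈ Metric.ball (e p) r := by simpa [e.right_inv hx] using hq.2
  refine (A.transform_eq_zero_iff c hc he hx ?_ fun a b =>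
    ((hΩs a b).contMDiffAt (hUo.mem_nhds hq)).mdifferentiableAt (by simp)).2 (fun i => ?_) v
  · exact Matrix.isUnit_det_of_left_inverse
      (GaugeGroup.conjTranspose_mul_self (A.mem_group_of_mpd_eq c hEd hE hE0 hq.2))
  · rw [e.right_inv hx, ← hE x hxb]
    refine mpd_congr ?_ i
    filter_upwards [e.open_target.mem_nhds hx] with y hy
    rw [e.right_inv hy]

/-- If the gauge field can be gauged away by `Ω`, the columns of `Ω⁻¹` are a parallel frame. -/
theorem GaugeField.hasParallelFrameNear_of_not_neZero [IsManifold (𝓡 d) ∞ M] (hc : c ≠ 0) {p : M}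
    (h : ¬ A.NeZeroInAllGauges c p) : A.HasParallelFrameNear c p := by
  simp only [NeZeroInAllGauges, not_forall, not_exists, not_and, not_not] at h
  obtain ⟨U, Ω, hU, hp, hG, hΩ, h0⟩ := h
  have hss : ∀ a, ContMDiffOn (𝓡 d) 𝓘(ℝ, Fin n → ℂ) ∞ (fun q b => star (Ω q a b)) U := fun a =>
    contMDiffOn_pi_space.2 fun b =>
      (Complex.conjCLE : ℂ ≃L[ℝ] ℂ).contDiff.contMDiff.comp_contMDiffOn (hΩ a b)
  refine ⟨U, hU, hp, fun a q b => star (Ω q a b), hss, fun q hq => ?_, fun q hq a v => ?_⟩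
  · have h1 := GaugeGroup.conjTranspose_mul_self (hG q hq)
    have h2 : IsUnit ((Ω q).conjTranspose.transpose) := by
      rw [Matrix.isUnit_transpose]
      exact IsUnit.of_mul_eq_one _ h1
    exact Matrix.linearIndependent_rows_iff_isUnit.2 h2
  · obtain ⟨e, he, x, hx, rfl⟩ : ∃ e : OpenPartialHomeomorph M (Coord d), IsCoord e ∧
        ∃ x ∈ e.target, e.symm x = q :=
      ⟨_, IsManifold.chart_mem_maximalAtlas q, _, mem_chart_target _ q,
        (chartAt (Coord d) q).left_inv (mem_chart_source _ q)⟩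
    have hm : MDifferentiableAt (𝓡 d) 𝓘(ℝ, Fin n → ℂ) (fun q b => star (Ω q a b)) (e.symm x) :=
      ((hss a).contMDiffAt (hU.mem_nhds hq)).mdifferentiableAt (by simp)
    have h1 := (A.transform_eq_zero_iff c hc he hx
      (Matrix.isUnit_det_of_left_inverse (GaugeGroup.conjTranspose_mul_self (hG _ hq)))
      (fun a b => ((hΩ a b).contMDiffAt (hU.mem_nhds hq)).mdifferentiableAt (by simp))).1
      (h0 _ hq)
    refine (A.covDeriv_eq_zero_iff c he hx hm).2 (fun i => ?_) v
    have hd : DifferentiableAt ℝ (fun y b => star (Ω (e.symm y) a b)) x := by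
      rw [← mdifferentiableAt_iff_differentiableAt]
      exact hm.comp x (he.mdifferentiable.mdifferentiableAt_symm hx)
    have hA : (A.comp e i x).conjTranspose = A.comp e i x := A.isHermitian _ _
    have h2 := congrArg Matrix.conjTranspose (h1 i)
    rw [Matrix.conjTranspose_mul, Matrix.conjTranspose_smul, hA] at h2
    ext b
    have h3 := congrFun (congrFun h2 b) a
    rw [Matrix.conjTranspose_apply, mpd_apply, ← pd_star] at h3
    rw [Pi.add_apply, pd_apply hd, h3]
    simp [Matrix.mul_apply, Matrix.mulVec, dotProduct, Finset.mul_sum, mul_assoc]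

/-- A parallel frame forces the curvature to vanish: the matrix `S` whose rows are the sections of
the frame is invertible and satisfies `∂_k S = -i c S A_kᵀ`. -/
theorem GaugeField.curvature_eq_zero_of_hasParallelFrameNear [IsManifold (𝓡 d) ∞ M] (hc : c ≠ 0)
    (he : IsCoord e) {x : Coord d} (hx : x ∈ e.target)
    (h : A.HasParallelFrameNear c (e.symm x)) (i j : Fin d) : A.curvature c e i j x = 0 := by
  obtain ⟨U, hU, hp, s, hs, hli, hpar⟩ := h
  have hW : IsOpen (e.target ∩ e.symm ⁻¹' U) := e.symm.isOpen_inter_preimage hU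
  have hss : ∀ a, ContDiffOn ℝ ∞ (fun y => s a (e.symm y)) (e.target ∩ e.symm ⁻¹' U) := fun a =>
    contMDiffOn_iff_contDiffOn.1 ((hs a).comp
      ((contMDiffOn_symm_of_mem_maximalAtlas he).mono inter_subset_left) fun y hy => hy.2)
  set S : Coord d → Matrix (Fin n) (Fin n) ℂ := fun y => Matrix.of fun a b => s a (e.symm y) b
    with hS
  have hSs : ∀ a b, ContDiffOn ℝ ∞ (fun y => S y a b) (e.target ∩ e.symm ⁻¹' U) := fun a b =>
    contDiffOn_pi.1 (hss a) b
  have hSd : ∀ y ∈ e.target ∩ e.symm ⁻¹' U, ∀ k,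
      mpd k S y = S y * (-(Complex.I * (c : ℂ)) • (A.comp e k y).transpose) := by
    intro y hy k
    ext a b
    have h1 := (A.covDeriv_eq_zero_iff c he hy.1
      (((hs a).contMDiffAt (hU.mem_nhds hy.2)).mdifferentiableAt (by simp))).1
      (hpar _ hy.2 a) k
    have h2 := congrFun h1 b
    rw [Pi.add_apply, pd_apply
      (((hss a).contDiffAt (hW.mem_nhds hy)).differentiableAt (by simp))] at h2
    rw [mpd_apply, Matrix.mul_smul, neg_smul, Matrix.neg_apply]
    refine (eq_neg_of_add_eq_zero_left h2).trans ?_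
    simp only [Pi.smul_apply, Matrix.smul_apply, Matrix.mul_apply, Matrix.mulVec, dotProduct,
      Matrix.transpose_apply, hS, Matrix.of_apply]
    congr 2
    exact Finset.sum_congr rfl fun l _ => mul_comm _ _
  have hcurv := mul_curvature_eq_zero (E := S) (x := x)
    (M := fun k y => -(Complex.I * (c : ℂ)) • (A.comp e k y).transpose)
    (fun a b => ((hSs a b).contDiffAt (hW.mem_nhds ⟨hx, hp⟩)).of_le ENat.LEInfty.out)
    (fun k a b => (A.differentiableAt_comp he hx k b a).const_mul _)
    (Filter.eventually_of_mem (hW.mem_nhds ⟨hx, hp⟩) hSd) i j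
  have hu : IsUnit (S x) := Matrix.linearIndependent_rows_iff_isUnit.1 (hli _ hp)
  have hz := hu.mul_right_eq_zero.1 hcurv
  have hm : ∀ k l, mpd k (fun y => -(Complex.I * (c : ℂ)) • (A.comp e l y).transpose) x =
      -(Complex.I * (c : ℂ)) • (mpd k (A.comp e l) x).transpose := fun k l => by
    rw [mpd_const_smul _ (fun y => (A.comp e l y).transpose) x
      (fun a b => A.differentiableAt_comp he hx l b a), mpd_transpose]
  rw [hm, hm] at hz
  have hF : -(Complex.I * (c : ℂ)) • (A.curvature c e i j x).transpose = 0 := by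
    rw [← hz, A.curvature_eq]
    simp only [Matrix.transpose_add, Matrix.transpose_sub, Matrix.transpose_smul,
      Matrix.transpose_mul, Matrix.smul_mul, Matrix.mul_smul, smul_add, smul_sub, smul_smul,
      Matrix.mul_neg, neg_neg, neg_mul, neg_smul]
    abel
  have hc' : -(Complex.I * (c : ℂ)) ≠ 0 :=
    neg_ne_zero.2 (mul_ne_zero Complex.I_ne_zero (by exact_mod_cast hc))
  have h3 := (smul_eq_zero_iff_right hc').1 hF
  simpa using congrArg Matrix.transpose h3

theorem GaugeField.isTwisted_iff [IsManifold (𝓡 d) ∞ M] (hc : c ≠ 0) :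
    A.IsTwisted c ↔ ∃ p : M, A.NeZeroInAllGauges c p := by
  constructor
  · rintro ⟨e, he, x, hx, i, j, hne⟩
    refine ⟨e.symm x, ?_⟩
    by_contra h
    exact hne (A.curvature_eq_zero_of_hasParallelFrameNear c hc he hx
      (A.hasParallelFrameNear_of_not_neZero c hc h) i j)
  · rintro ⟨p, hp⟩
    by_contra h
    simp only [IsTwisted, not_exists, not_and, not_not] at h
    have he := IsManifold.chart_mem_maximalAtlas (I := 𝓡 d) (n := ∞) p
    exact A.not_neZeroInAllGauges_of_curvature c hc he (mem_chart_source _ p)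
      (fun x hx => h _ he x hx) hp

theorem GaugeField.isGeometricallyNontrivial_iff [IsManifold (𝓡 d) ∞ M] (hc : c ≠ 0) :
    A.IsGeometricallyNontrivial c ↔ ∃ p : M, A.NeZeroInAllGauges c p := by
  constructor
  · rintro ⟨p, hp⟩
    exact ⟨p, not_imp_comm.1 (A.hasParallelFrameNear_of_not_neZero c hc) hp⟩
  · intro h
    obtain ⟨e, he, x, hx, i, j, hne⟩ := (A.isTwisted_iff c hc).2 h
    exact ⟨e.symm x, fun hf =>
      hne (A.curvature_eq_zero_of_hasParallelFrameNear c hc he hx hf i j)⟩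

theorem GaugeField.exists_covDeriv_ne_flatDeriv_iff (hc : c ≠ 0) :
    (∃ s : M → Fin n → ℂ, ContMDiff (𝓡 d) 𝓘(ℝ, Fin n → ℂ) ∞ s ∧
      ∃ p v, A.covDeriv c s p v ≠ flatDeriv s p v) ↔ ∃ p v, A.val p v ≠ 0 := by
  constructor
  · rintro ⟨s, -, p, v, h⟩
    refine ⟨p, v, fun h0 => h ?_⟩
    simp [covDeriv, h0]
  · rintro ⟨p, v, h⟩
    -- A constant section `u` with `A(v) u ≠ 0` detects the difference.
    obtain ⟨u, hu⟩ : ∃ u, (A.val p v).mulVec u ≠ 0 := by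
      by_contra! h0
      refine h (Matrix.mulVec_injective ?_)
      ext1 u
      rw [h0, Matrix.zero_mulVec]
    refine ⟨fun _ => u, contMDiff_const, p, v, fun h1 => ?_⟩
    have hc' : Complex.I * (c : ℂ) ≠ 0 := mul_ne_zero Complex.I_ne_zero (by exact_mod_cast hc)
    exact smul_ne_zero hc' hu (add_eq_left.1 h1)

end Gauge

end GeomInteraction

end

theorem theorem3p1 {d : ℕ} {M : Type*} [TopologicalSpace M]
    [ChartedSpace (GeomInteraction.Coord d) M] [IsManifold (𝓡 d) ∞ M]
    {ε : Fin d → ℤˣ} (g : GeomInteraction.Metric d M ε)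
    {K : GeomInteraction.GaugeGroup} {n : ℕ} (A : GeomInteraction.GaugeField d M K n)
    (c : ℝ) (hc : c ≠ 0) :
    ((g.IsCurved ↔ ∃ p : M, g.ChristoffelNeZero p) ∧
      (g.IsCurved ↔ ∃ p : M, g.CompNeEta p) ∧
      ∀ p : M, g.ChristoffelNeZero p ↔ g.CompNeEta p) ∧
    ((A.IsTwisted c ↔ ∃ p : M, A.NeZeroInAllGauges c p) ∧
      (A.IsGeometricallyNontrivial c ↔ ∃ p : M, A.NeZeroInAllGauges c p) ∧
      ((∃ s : M → Fin n → ℂ, ContMDiff (𝓡 d) 𝓘(ℝ, Fin n → ℂ) ∞ s ∧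
          ∃ p v, A.covDeriv c s p v ≠ GeomInteraction.GaugeField.flatDeriv s p v) ↔
        ∃ p v, A.val p v ≠ 0)) := by
  have h1 := g.christoffelNeZero_iff_compNeEta
  have h2 := g.isCurved_iff_exists_compNeEta
  exact ⟨⟨h2.trans (exists_congr fun p => (h1 p).symm), h2, h1⟩,
    A.isTwisted_iff c hc, A.isGeometricallyNontrivial_iff c hc,
    A.exists_covDeriv_ne_flatDeriv_iff c hc⟩
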